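/- A Steiner system $S(t,k,n)$ is a set $E$ of $n$ points together with a family $\mathcal H$ of $k$-subsets of $E$ (blocks) such that every $t$-subset of $E$ is contained in a unique block. Let $r\ge 1$ and $r-1\le k<n$. For a Steiner system $S(r-1,k,n)$ on $E$, let $M$ be the matroid on $E$ whose bases are the $r$-subsets of $E$ contained in no block. For a matroid $M$ on a finite set $E$, let $\mathcal P_M\subset\mathbb R^E$ be the convex hull of the indicator vectors of the bases, and let $\mathrm{ehr}_M$ be its Ehrhart polynomial, i.e. the polynomial with $\mathrm{ehr}_M(t)=|t\mathcal P_M\cap\mathbb Z^E|$ for all integers $t\ge 0$. Let $U_{r,n}$ be the uniform matroid of rank $r$ on $n$ elements. For integers $r\ge1$ and $0\le s<n$, put $$\tilde\phi_{r,s,n}(t)=\sum_{i=0}^{s-r}(-1)^i\binom{s}{i}\sum_{\ell=0}^{s-1}(n-2-\ell)!\,\ell!\,\binom{s-2-\ell-i+t(s-r-i+1)}{s-1-\ell}\binom{s-1-i+t(s-r-i)}{\ell},$$ where binomial coefficients with $t$ in the upper entry are polynomials, $\binom{x}{m}=x(x-1)\cdots(x-m+1)/m!$, and the outer sum is empty if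 $s<r$. (1) $M$ is a paving matroid of rank $r$ (every circuit has at least $r$ elements) whose hyperplanes are exactly the blocks. The Ehrhart polynomials of $U_{r,n}$ and of $M$ exist, and $$\mathrm{ehr}_M(t)=\mathrm{ehr}_{U_{r,n}}(t)-\frac{\binom{n}{r-1}}{\binom{k}{r-1}}\,\frac{n-k}{(n-1)!}\binom{t-1+n-k}{n-k}\,\tilde\phi_{r,k,n}(t).$$ (2) In particular, let $M$ be the rank-3 matroid obtained in this way from a finite projective plane of order $q\ge2$, regarded as the Steiner system $S(2,q+1,q^2+q+1)$ whose blocks are the lines, and let $n=q^2+q+1$. Then $$\mathrm{ehr}_M(t)=\mathrm{ehr}_{U_{3,n}}(t)-\frac{\binom{n}{2}}{\binom{q+1}{2}}\,\frac{q^2}{(q^2+q)!}\binom{t+q^2-1}{n-q-1}\,\tilde\phi_{3,q+1,q^2+q+1}(t).$$ (3) If two Steiner systems have the same parameters $(r-1,k,n)$, with $r\ge1$ and $r-1\le k<n$, then the base polytopes of their matroids have the same Ehrhart polynomial and the same volume. Here the volume of a polytope $P$ is taken with respect to the lattice $\mathbb Z^E\cap A(P)$, where $A(P)$ is the affine span of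 $P$; equality holds both when a fundamental cell of the lattice has volume $1$ and when a unimodular simplex has volume $1$. -/

import Mathlib

open Polynomial
open scoped Pointwise

noncomputable section

/-! ### Steiner systems and the matroids they define -/

/-- A Steiner system `S(t, k, n)` on the ground set `E`: `n` points and a family of `k`-subsets
(blocks) such that every `t`-subset of `E` is contained in a unique block. -/
structure SteinerSystem (E : Type*) [Fintype E] (t k n : ℕ) where
  card_ground : Fintype.card E = n
  blocks : Set (Finset E)
  card_block : ∀ H ∈ blocks, H.card = k
  existsUnique_block : ∀ T : Finset E, T.card = t → ∃! H, H ∈ blocks ∧ T ⊆ H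

/-- The bases of the rank-`r` matroid of a Steiner system: the `r`-subsets of `E` that are not
contained in a block. -/
def SteinerSystem.IsMatroidBase {E : Type*} [Fintype E] {t k n : ℕ} (S : SteinerSystem E t k n)
    (r : ℕ) (B : Set E) : Prop :=
  B.ncard = r ∧ ∀ H ∈ S.blocks, ¬ B ⊆ (H : Set E)

theorem SteinerSystem.exists_isMatroidBase {E : Type*} [Fintype E] {r k n : ℕ}
    (S : SteinerSystem E (r - 1) k n) (hr : 1 ≤ r) (hrk : r - 1 ≤ k) (hkn : k < n) :
    ∃ B, S.IsMatroidBase r B := by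
  classical
  have hn : r - 1 ≤ (Finset.univ : Finset E).card := by
    rw [Finset.card_univ, S.card_ground]; omega
  obtain ⟨T, -, hT⟩ := Finset.exists_subset_card_eq hn
  obtain ⟨H, ⟨hH, hTH⟩, huniq⟩ := S.existsUnique_block T hT
  have hlt : H.card < (Finset.univ : Finset E).card := by
    rw [S.card_block H hH, Finset.card_univ, S.card_ground]; exact hkn
  obtain ⟨x, -, hx⟩ := Finset.exists_mem_notMem_of_card_lt_card hlt
  refine ⟨((insert x T : Finset E) : Set E), ?_, ?_⟩
  · rw [Set.ncard_coe_finset, Finset.card_insert_of_notMem (fun h => hx (hTH h)), hT]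
    omega
  · intro H' hH' hsub
    rw [Finset.coe_subset] at hsub
    have : H' = H := huniq H' ⟨hH', fun y hy => hsub (Finset.mem_insert_of_mem hy)⟩
    exact hx (this ▸ hsub (Finset.mem_insert_self x T))

theorem SteinerSystem.exchangeProperty {E : Type*} [Fintype E] {r k n : ℕ}
    (S : SteinerSystem E (r - 1) k n) (hr : 1 ≤ r) :
    Matroid.ExchangeProperty (S.IsMatroidBase r) := by
  classical
  rintro A B ⟨hA, hA'⟩ ⟨hB, hB'⟩ e ⟨heA, heB⟩
  have hc : (A \ {e}).ncard = r - 1 := by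
    rw [Set.ncard_sdiff_singleton_of_mem heA, hA]
  obtain ⟨H, ⟨hH, hTH⟩, huniq⟩ := S.existsUnique_block (A \ {e}).toFinset (by
    rw [← Set.ncard_eq_toFinset_card', hc])
  have hTH' : A \ {e} ⊆ (H : Set E) := fun y hy => hTH (by simpa using hy)
  obtain ⟨y, hyB, hyH⟩ : ∃ y ∈ B, y ∉ (H : Set E) := by
    by_contra! hcon
    exact hB' H hH hcon
  have hyA : y ∉ A := fun h => hyH (hTH' ⟨h, fun h' => heB (by
    rw [Set.mem_singleton_iff] at h'; exact h' ▸ hyB)⟩)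
  refine ⟨y, ⟨hyB, hyA⟩, ?_, ?_⟩
  · rw [Set.ncard_insert_of_notMem (fun h => hyA h.1), hc]
    omega
  · intro H' hH' hsub
    have : H' = H := huniq H' ⟨hH', fun z hz => by
      have hz' : z ∈ A \ {e} := by simpa using hz
      exact hsub (Set.mem_insert_of_mem _ hz')⟩
    exact hyH (this ▸ hsub (Set.mem_insert y _))

/-- The rank-`r` paving matroid of a Steiner system `S(r - 1, k, n)`, `r - 1 ≤ k < n`. -/
def SteinerSystem.matroid {E : Type*} [Fintype E] {r k n : ℕ}
    (S : SteinerSystem E (r - 1) k n) (hr : 1 ≤ r) (hrk : r - 1 ≤ k) (hkn : k < n) :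
    Matroid E :=
  Matroid.ofIsBaseOfFinite (E := Set.univ) Set.finite_univ (S.IsMatroidBase r)
    (S.exists_isMatroidBase hr hrk hkn) (S.exchangeProperty hr) (fun _ _ => Set.subset_univ _)

/-- The uniform matroid `U_{r,n}` on `Fin n`: the bases are all `r`-subsets. -/
def uniformMatroid (r n : ℕ) (h : r ≤ n) : Matroid (Fin n) :=
  Matroid.ofIsBaseOfFinite (E := Set.univ) Set.finite_univ (fun B => B.ncard = r)
    (by
      obtain ⟨T, -, hT⟩ := Finset.exists_subset_card_eq (s := (Finset.univ : Finset (Fin n)))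
        (n := r) (by simpa using h)
      exact ⟨(T : Set (Fin n)), by rw [Set.ncard_coe_finset, hT]⟩)
    (by
      rintro A B hA hB e ⟨heA, heB⟩
      obtain ⟨y, hyB, hyA⟩ : ∃ y ∈ B, y ∉ A := by
        by_contra! hcon
        have hAB : B = A := Set.eq_of_subset_of_ncard_le hcon (by rw [hA, hB]) (Set.toFinite A)
        exact heB (hAB ▸ heA)
      refine ⟨y, ⟨hyB, hyA⟩, ?_⟩
      change (insert y (A \ {e})).ncard = r
      rw [Set.ncard_insert_of_notMem (fun h => hyA h.1),
        Set.ncard_sdiff_singleton_add_one heA, hA])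
    (fun _ _ => Set.subset_univ _)

/-- A matroid is paving if every circuit has at least as many elements as the rank. -/
def Matroid.IsPaving {E : Type*} (M : Matroid E) : Prop :=
  ∀ C, M.IsCircuit C → M.eRank ≤ C.encard

/-- A hyperplane of a matroid is a flat whose rank is one less than the rank of the matroid. -/
def Matroid.IsHyperplane {E : Type*} (M : Matroid E) (H : Set E) : Prop :=
  M.IsFlat H ∧ M.eRk H + 1 = M.eRank

/-- A finite projective plane of order `q`, with its lines regarded as sets of points, is a
Steiner system `S(2, q + 1, q² + q + 1)`. -/
def planeSteinerSystem (P L : Type*) [Membership P L] [Configuration.ProjectivePlane P L]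
    [Fintype P] [Finite L] (q : ℕ) (hq : Configuration.ProjectivePlane.order P L = q) :
    SteinerSystem P 2 (q + 1) (q ^ 2 + q + 1) where
  card_ground := by rw [Configuration.ProjectivePlane.card_points P L, hq]
  blocks := {H | ∃ l : L, ∀ p, p ∈ H ↔ p ∈ l}
  card_block := by
    rintro H ⟨l, hl⟩
    have h := Configuration.ProjectivePlane.pointCount_eq P l
    rw [hq, Configuration.pointCount] at h
    rw [← h, ← Nat.card_eq_finsetCard H]
    exact Nat.card_congr (Equiv.subtypeEquivRight hl)
  existsUnique_block := by
    classical
    intro T hT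
    obtain ⟨x, y, hxy, rfl⟩ := Finset.card_eq_two.mp hT
    have hax := Configuration.HasLines.mkLine_ax (P := P) (L := L) hxy
    refine ⟨Finset.univ.filter (· ∈ Configuration.HasLines.mkLine (L := L) hxy),
      ⟨⟨Configuration.HasLines.mkLine hxy, fun p => by simp⟩, ?_⟩, ?_⟩
    · intro p hp
      rw [Finset.mem_insert, Finset.mem_singleton] at hp
      rcases hp with rfl | rfl <;> simp [hax.1, hax.2]
    · rintro H ⟨⟨l, hl⟩, hsub⟩
      have hx : x ∈ l := (hl x).1 (hsub (by simp))
      have hy : y ∈ l := (hl y).1 (hsub (by simp))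
      have : l = Configuration.HasLines.mkLine (L := L) hxy :=
        (Configuration.Nondegenerate.eq_or_eq hx hy hax.1 hax.2).resolve_left hxy
      ext p
      simp [hl, this]

/-- The rank-3 paving matroid of a finite projective plane of order `q ≥ 2`. -/
def planeMatroid (P L : Type*) [Membership P L] [Configuration.ProjectivePlane P L]
    [Fintype P] [Finite L] (q : ℕ) (hq : Configuration.ProjectivePlane.order P L = q)
    (hq2 : 2 ≤ q) : Matroid P :=
  SteinerSystem.matroid (r := 3) (planeSteinerSystem P L q hq) (by omega) (by omega)
    (by nlinarith)

/-! ### Base polytopes, Ehrhart polynomials and volumes -/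

/-- The base polytope of a matroid on `E`: the convex hull in `ℝ^E` of the indicator vectors of
the bases. -/
def Matroid.basePolytope {E : Type*} (M : Matroid E) : Set (E → ℝ) :=
  convexHull ℝ ((fun B : Set E => B.indicator (fun _ => (1 : ℝ))) '' {B | M.IsBase B})

/-- The Ehrhart function `t ↦ |tP ∩ ℤ^E|`. -/
def ehrhartFunction {E : Type*} (P : Set (E → ℝ)) (t : ℕ) : ℕ :=
  {z : E → ℤ | (fun i => (z i : ℝ)) ∈ (t : ℝ) • P}.ncard

/-- `f` is the Ehrhart polynomial of `P`: it takes the value `|tP ∩ ℤ^E|` at every natural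
number `t` (which determines `f`). -/
def IsEhrhartPolynomial {E : Type*} (P : Set (E → ℝ)) (f : ℚ[X]) : Prop :=
  ∀ t : ℕ, f.eval (t : ℚ) = (ehrhartFunction P t : ℚ)

/-- The lattice of integer vectors that are parallel to the affine span of `P`. -/
def directionLattice {E : Type*} (P : Set (E → ℝ)) : Submodule ℤ (E → ℤ) where
  carrier := {v | (fun i => (v i : ℝ)) ∈ vectorSpan ℝ P}
  add_mem' := by
    intro a b ha hb
    simpa [Pi.add_def] using (vectorSpan ℝ P).add_mem ha hb
  zero_mem' := by
    simpa [Pi.zero_def] using (vectorSpan ℝ P).zero_mem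
  smul_mem' := by
    intro c a ha
    simpa [Pi.smul_def] using (vectorSpan ℝ P).smul_mem (c : ℝ) ha

/-- The relative volume of a lattice polytope `P`: its volume with respect to the lattice of
integer points in its affine span, so that a fundamental cell of the lattice has volume one. It is
computed as the Lebesgue measure of `P` in the coordinates given by a point of `P` as origin and a
`ℤ`-basis of the direction lattice; it does not depend on these choices. -/
def relativeVolume {E : Type*} [Finite E] (P : Set (E → ℝ)) : ENNReal :=
  open Classical in
  if h : P.Nonempty then
    MeasureTheory.volume {c : Fin (Module.finrank ℤ (directionLattice P)) → ℝ |
      (fun i => h.some i + ∑ j, c j *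
        (((Module.finBasis ℤ (directionLattice P) j : directionLattice P) : E → ℤ) i : ℝ)) ∈ P}
  else 0

/-- The volume in the other usual normalization, `(dim P)!` times the relative volume, in which a
unimodular simplex has volume one. -/
def normalizedVolume {E : Type*} [Finite E] (P : Set (E → ℝ)) : ENNReal :=
  ((Module.finrank ℤ (directionLattice P)).factorial : ENNReal) * relativeVolume P

/-! ### The polynomials in the formulas -/

/-- The binomial coefficient `f (f - 1) ⋯ (f - m + 1) / m!` of a polynomial `f`. -/
def binomPoly (f : ℚ[X]) (m : ℕ) : ℚ[X] :=
  C (1 / (m.factorial : ℚ)) * ∏ j ∈ Finset.range m, (f - C (j : ℚ))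

/-- The polynomial `φ̃_{r,s,n}(t)`; the outer sum is over `0 ≤ i ≤ s - r` (empty if `s < r`), the
inner one over `0 ≤ ℓ ≤ s - 1`. It is used for `s < n`, where `n - 2 - ℓ ≥ 0`. -/
def phiTilde (r s n : ℕ) : ℚ[X] :=
  ∑ i ∈ Finset.range (s + 1 - r), C ((-1 : ℚ) ^ i * (s.choose i : ℚ)) *
    ∑ l ∈ Finset.range s, C (((n - 2 - l).factorial : ℚ) * (l.factorial : ℚ)) *
      binomPoly (C ((s : ℚ) - 2 - l - i) + X * C ((s : ℚ) - r - i + 1)) (s - 1 - l) *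
      binomPoly (C ((s : ℚ) - 1 - i) + X * C ((s : ℚ) - r - i)) l

end

/-! Two distinct blocks share at most `r - 2` points, since an `(r - 1)`-set lies in only one block.
This gives both halves of the argument.

Polytope: the base polytope is the hypersimplex cut by `x(H) ≤ r - 1` for the blocks `H`
(`convexHull_indicator_eq_blockPolytope`). The small intersections make the extreme points of the
cut polytope integral, and its 0/1 points are exactly the indicators of bases.

Counting: the lattice points of the `t`-th dilate of the hypersimplex are the `y ∈ {0, …, t}^E` with
sum `r t`. A block `H` removes those with `y(H) > (r - 1) t`, and no point is removed by two blocks,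
because `y(H) + y(H') = y(H ∪ H') + y(H ∩ H') ≤ r t + (r - 2) t`. Hence `ehr_U - ehr_M` is the
number of blocks, found by double counting, times the number of points removed by one `k`-set
(`excessCount_eq_eval`). To find the latter, fix the sum `j < t` of the coordinates off `H`: the
count off `H` is one binomial coefficient, the count on `H` is an inclusion-exclusion sum, and the
sum over `j` of their product is evaluated by a telescoping recurrence (`innerSum_recurrence`),
which produces `phiTilde`.

Volume: the Ehrhart function of a lattice polytope grows like its relative volume times `t ^ dim`.
As this volume is positive and finite, the function determines both the dimension and the volume. -/

noncomputable section

/-! ### Binomial coefficients with rational upper entry -/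

/-- The binomial coefficient `x (x - 1) ⋯ (x - m + 1) / m!`. -/
def ratChoose (x : ℚ) (m : ℕ) : ℚ :=
  1 / (m.factorial : ℚ) * ∏ j ∈ Finset.range m, (x - (j : ℚ))

theorem eval_binomPoly (f : ℚ[X]) (m : ℕ) (x : ℚ) :
    (binomPoly f m).eval x = ratChoose (f.eval x) m := by
  simp [binomPoly, ratChoose, eval_prod]

theorem ratChoose_zero_right (x : ℚ) : ratChoose x 0 = 1 := by
  simp [ratChoose]

theorem succ_mul_ratChoose_succ (x : ℚ) (m : ℕ) :
    ((m : ℚ) + 1) * ratChoose x (m + 1) = (x - m) * ratChoose x m := by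
  have h : (m.factorial : ℚ) ≠ 0 := by positivity
  have h' : (m : ℚ) + 1 ≠ 0 := by positivity
  simp only [ratChoose, Finset.prod_range_succ, Nat.factorial_succ]
  push_cast
  field_simp

theorem succ_mul_ratChoose_add_one (x : ℚ) (m : ℕ) :
    ((m : ℚ) + 1) * ratChoose (x + 1) (m + 1) = (x + 1) * ratChoose x m := by
  have h : (m.factorial : ℚ) ≠ 0 := by positivity
  have h' : (m : ℚ) + 1 ≠ 0 := by positivity
  have h2 : ∏ j ∈ Finset.range m, (x + 1 - ((j + 1 : ℕ) : ℚ)) = ∏ j ∈ Finset.range m, (x - (j : ℚ)) :=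
    Finset.prod_congr rfl fun j _ => by push_cast; ring
  simp only [ratChoose, Finset.prod_range_succ', Nat.factorial_succ, h2]
  push_cast
  field_simp
  ring

theorem ratChoose_add_one_succ (x : ℚ) (m : ℕ) :
    ratChoose (x + 1) (m + 1) = ratChoose x m + ratChoose x (m + 1) := by
  have h' : (m : ℚ) + 1 ≠ 0 := by positivity
  apply mul_left_cancel₀ h'
  rw [succ_mul_ratChoose_add_one, mul_add, succ_mul_ratChoose_succ]
  ring

theorem ratChoose_natCast (N m : ℕ) : ratChoose (N : ℚ) m = (N.choose m : ℚ) := by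
  induction N generalizing m with
  | zero =>
    cases m with
    | zero => simp [ratChoose]
    | succ m => simp [ratChoose, Finset.prod_range_succ']
  | succ N ih =>
    cases m with
    | zero => simp [ratChoose]
    | succ m =>
      rw [Nat.cast_succ, ratChoose_add_one_succ, ih, ih, Nat.choose_succ_succ]
      push_cast
      rfl

/-! ### A convolution of binomial coefficients summed by telescoping -/

/-- The sum that appears in `phiTilde`, with `N = s - 1` and `m = n - s`. -/
def innerSum (m N : ℕ) (a t : ℚ) : ℚ :=
  ∑ l ∈ Finset.range (N + 1), (((m + N - 1 - l).factorial : ℚ) * (l.factorial : ℚ)) *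
    ratChoose (a + t - 1 - l) (N - l) * ratChoose a l

/-- The terms of the telescoping sum behind `innerSum_recurrence`. -/
def telescopeTerm (m N : ℕ) (a t : ℚ) (l : ℕ) : ℚ :=
  if l ≤ N then ((m + N - l).factorial : ℚ) * (l.factorial : ℚ) *
    ratChoose (a + t - l) (N - l) * ratChoose a l else 0

/-- Summand by summand the left side is `telescopeTerm l - telescopeTerm (l + 1)`, by Pascal's rule
and the two absorption identities, so only the term at `l = 0` survives. The condition `1 ≤ m` keeps
`m + N - 1 - l` from being truncated at `l = N`. -/
theorem innerSum_recurrence (m N : ℕ) (hm : 1 ≤ m) (a t : ℚ) :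
    (t + m) * innerSum m N a (t + 1) - t * innerSum m N a t =
      ((m + N).factorial : ℚ) * ratChoose (a + t) N := by
  have key : ∀ l ∈ Finset.range (N + 1),
      (t + m) * ((((m + N - 1 - l).factorial : ℚ) * (l.factorial : ℚ)) *
        ratChoose (a + (t + 1) - 1 - l) (N - l) * ratChoose a l) -
      t * ((((m + N - 1 - l).factorial : ℚ) * (l.factorial : ℚ)) *
        ratChoose (a + t - 1 - l) (N - l) * ratChoose a l) =
      telescopeTerm m N a t l - telescopeTerm m N a t (l + 1) := by
    intro l hl
    have hl' : l ≤ N := by simpa [Nat.lt_succ_iff] using hl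
    obtain ⟨p, rfl⟩ := Nat.exists_eq_add_of_le hl'
    have e1 : m + (l + p) - l = (m + p - 1) + 1 := by omega
    have e2 : m + (l + p) - 1 - l = m + p - 1 := by omega
    have e3 : l + p - l = p := by omega
    have e4 : ((m + p - 1 : ℕ) : ℚ) = m + p - 1 := by
      rw [Nat.cast_sub (by omega)]; push_cast; ring
    have e5 : a + (t + 1) - 1 - l = a + t - l := by ring
    rw [telescopeTerm, if_pos hl', e1, e2, e3, Nat.factorial_succ, e5]
    push_cast
    rw [e4]
    -- Here `p = N - l`. For `p = 0` the next telescoping term is zero by convention, and the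
    -- identity reduces to `(t + m) - t = m`.
    cases p with
    | zero =>
      rw [telescopeTerm, if_neg (by omega)]
      simp only [ratChoose_zero_right]
      push_cast
      ring
    | succ p =>
      rw [telescopeTerm, if_pos (by omega)]
      have f1 : l + (p + 1) - (l + 1) = p := by omega
      have f2 : m + (l + (p + 1)) - (l + 1) = m + (p + 1) - 1 := by omega
      rw [f1, f2, Nat.factorial_succ l]
      have g1 := succ_mul_ratChoose_succ a l
      have g2 := ratChoose_add_one_succ (a + t - l - 1) p
      have g3 := succ_mul_ratChoose_add_one (a + t - l - 1) p
      rw [show a + t - l - 1 + 1 = a + t - l by ring] at g2 g3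
      have g4 : a + t - 1 - l = a + t - l - 1 := by ring
      have g5 : a + t - ((l + 1 : ℕ) : ℚ) = a + t - l - 1 := by push_cast; ring
      rw [g4, g5]
      push_cast
      generalize ratChoose (a + t - l - 1) p = A at *
      generalize ratChoose (a + t - l - 1) (p + 1) = B at *
      generalize ratChoose (a + t - l) (p + 1) = D at *
      generalize ratChoose a (l + 1) = R' at *
      generalize ratChoose a l = R at *
      generalize ((m + (p + 1) - 1).factorial : ℚ) = F at *
      generalize (l.factorial : ℚ) = G at *
      linear_combination (-F * G * t * R) * (-g2) - F * G * R * g3 + F * G * A * g1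
  have hsum := Finset.sum_congr (rfl : Finset.range (N + 1) = _) key
  rw [Finset.sum_sub_distrib, ← Finset.mul_sum, ← Finset.mul_sum, Finset.sum_range_sub'] at hsum
  rw [innerSum, innerSum, hsum, telescopeTerm, telescopeTerm, if_pos (Nat.zero_le _),
    if_neg (by omega)]
  simp [ratChoose_zero_right]

/-- Induction on `t`: absorption turns the binomials `(t + m + 1 choose m + 1)` and `(t + m choose m
+ 1)` into multiples of `(t + m choose m)`, and `innerSum_recurrence` then says that the right side
grows by the new summand. Since `a` does not involve `j`, it may afterwards be given a value that
depends on `t`. -/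
theorem sum_choose_mul_ratChoose (m N : ℕ) (a : ℚ) (t : ℕ) :
    ∑ j ∈ Finset.range t, ((j + m).choose m : ℚ) * ratChoose (a + j) N =
      ((m : ℚ) + 1) / ((m + 1 + N).factorial : ℚ) * ratChoose ((t : ℚ) + m) (m + 1) *
        innerSum (m + 1) N a t := by
  have hF : ((m + 1 + N).factorial : ℚ) ≠ 0 := by positivity
  induction t with
  | zero =>
    have h : ratChoose ((0 : ℕ) + m : ℚ) (m + 1) = 0 := by
      rw [← Nat.cast_add, ratChoose_natCast]; simp
    rw [h]; simp
  | succ t ih =>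
    rw [Finset.sum_range_succ, ih]
    have r := innerSum_recurrence (m + 1) N (by omega) a t
    have h1 := succ_mul_ratChoose_add_one ((t : ℚ) + m) m
    have h2 := succ_mul_ratChoose_succ ((t : ℚ) + m) m
    have h3 : ((t + m).choose m : ℚ) = ratChoose ((t : ℚ) + m) m := by
      rw [← Nat.cast_add, ratChoose_natCast]
    rw [h3]
    push_cast at r ⊢
    rw [show (t : ℚ) + 1 + m = t + m + 1 by ring]
    field_simp
    linear_combination (-ratChoose ((t : ℚ) + m) m) * r + innerSum (m + 1) N a t * h2 -
      innerSum (m + 1) N a (t + 1) * h1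

/-! ### Counting integer points of dilated cubes by coordinate sum -/

/-- The number of vectors in `{0, …, t}^E` with coordinate sum `m`. -/
def boxCount (E : Type*) [Fintype E] (t m : ℕ) : ℕ :=
  {y : E → ℕ | (∀ i, y i ≤ t) ∧ ∑ i, y i = m}.ncard

theorem coeff_sum_X_pow (t n : ℕ) :
    PowerSeries.coeff n (∑ j ∈ Finset.range (t + 1), (PowerSeries.X : PowerSeries ℚ) ^ j) =
      if n ≤ t then 1 else 0 := by
  simp [map_sum, PowerSeries.coeff_X_pow]

theorem boxCount_eq_coeff (E : Type*) [Fintype E] (t m : ℕ) :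
    (boxCount E t m : ℚ) = PowerSeries.coeff m
      ((∑ j ∈ Finset.range (t + 1), (PowerSeries.X : PowerSeries ℚ) ^ j) ^ Fintype.card E) := by
  classical
  rw [← Finset.card_univ, ← Finset.prod_const, PowerSeries.coeff_prod]
  simp only [coeff_sum_X_pow, Finset.prod_ite_zero, Finset.prod_const_one, Finset.sum_boole]
  norm_cast
  rw [boxCount, ← Set.ncard_coe_finset]
  symm
  refine Set.ncard_congr (fun l _ => (l : E → ℕ)) ?_ ?_ ?_
  · intro l hl
    simp at hl ⊢
    exact ⟨hl.2, hl.1⟩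
  · intro a b _ _ h
    exact DFunLike.coe_injective h
  · intro y hy
    refine ⟨Finsupp.equivFunOnFinite.symm y, ?_, ?_⟩
    · simp at hy ⊢
      exact ⟨hy.2, hy.1⟩
    · simp

/-- The generating function `(1 + X + ⋯ + X ^ t) ^ (K + 1)` equals `(1 - X ^ (t + 1)) ^ (K + 1) / (1
- X) ^ (K + 1)`; expand the numerator by the binomial theorem. -/
theorem boxCount_eq_sum (E : Type*) [Fintype E] (K : ℕ) (hK : Fintype.card E = K + 1) (t m : ℕ) :
    (boxCount E t m : ℚ) = ∑ i ∈ Finset.range (K + 2), (-1 : ℚ) ^ i * ((K + 1).choose i : ℚ) *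
      if i * (t + 1) ≤ m then ((m - i * (t + 1) + K).choose K : ℚ) else 0 := by
  have hgeom : (∑ j ∈ Finset.range (t + 1), (PowerSeries.X : PowerSeries ℚ) ^ j) ^ (K + 1) =
      (1 - PowerSeries.X ^ (t + 1)) ^ (K + 1) * (PowerSeries.invOneSubPow ℚ (K + 1)).val := by
    have h := PowerSeries.invOneSubPow_inv_eq_one_sub_pow ℚ (K + 1)
    rw [← geom_sum_mul_neg, mul_pow, ← h, mul_assoc, Units.inv_eq_val_inv, Units.inv_mul, mul_one]
  rw [boxCount_eq_coeff, hK, hgeom, sub_eq_neg_add, add_pow, Finset.sum_mul, map_sum]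
  refine Finset.sum_congr rfl fun i hi => ?_
  rw [one_pow, mul_one, neg_pow, ← pow_mul,
    PowerSeries.invOneSubPow_val_succ_eq_mk_add_choose]
  have : ((-1 : PowerSeries ℚ) ^ i * PowerSeries.X ^ ((t + 1) * i) * ((K + 1).choose i : PowerSeries ℚ)
      * PowerSeries.mk fun n => ((K + n).choose K : ℚ)) =
      PowerSeries.C ((-1 : ℚ) ^ i * ((K + 1).choose i : ℚ)) *
      (PowerSeries.X ^ ((t + 1) * i) * PowerSeries.mk fun n => ((K + n).choose K : ℚ)) := by
    simp
    ring
  rw [this, PowerSeries.coeff_C_mul, PowerSeries.coeff_X_pow_mul', PowerSeries.coeff_mk,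
    mul_comm (t + 1) i, add_comm K (m - _)]

theorem boxCount_of_le (E : Type*) [Fintype E] (K : ℕ) (hK : Fintype.card E = K + 1) {t m : ℕ}
    (hm : m ≤ t) : boxCount E t m = (m + K).choose K := by
  have h := boxCount_eq_sum E K hK t m
  rw [Finset.sum_eq_single 0] at h
  · simp at h; exact_mod_cast h
  · intro i _ hi
    rw [if_neg, mul_zero]
    have : 1 * (t + 1) ≤ i * (t + 1) := Nat.mul_le_mul_right _ (Nat.pos_of_ne_zero hi)
    omega
  · simp

/-- The reflection `y ↦ t - y` of the cube. On a block it replaces the sum `r t - j` by `(k - r) t +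
j`, which cuts inclusion-exclusion down to the range of the outer sum of `phiTilde`. -/
theorem boxCount_compl (E : Type*) [Fintype E] {t a b : ℕ} (h : a + b = Fintype.card E * t) :
    boxCount E t a = boxCount E t b := by
  have key : ∀ y : E → ℕ, (∀ i, y i ≤ t) → ∑ i, y i + ∑ i, (t - y i) = Fintype.card E * t := by
    intro y hy
    rw [← Finset.sum_add_distrib, Finset.sum_congr rfl fun i _ => Nat.add_sub_cancel' (hy i)]
    simp
  refine Set.ncard_congr (fun y _ i => t - y i) ?_ ?_ ?_
  · rintro y ⟨hy, hs⟩
    refine ⟨fun i => Nat.sub_le _ _, ?_⟩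
    have := key y hy
    change ∑ i, (t - y i) = b
    omega
  · rintro y z ⟨hy, -⟩ ⟨hz, -⟩ hyz
    funext i
    have := congrFun hyz i
    have := hy i
    have := hz i
    omega
  · rintro y ⟨hy, hs⟩
    refine ⟨fun i => t - y i, ⟨fun i => Nat.sub_le _ _, ?_⟩, ?_⟩
    · have := key y hy
      change ∑ i, (t - y i) = a
      omega
    · funext i
      exact Nat.sub_sub_self (hy i)

/-! ### Points that violate the inequality of one block -/

theorem ncard_sum_eq_and_sum_eq {E : Type*} [Fintype E] [DecidableEq E] (H : Finset E) (t a b : ℕ) :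
    {y : E → ℕ | (∀ i, y i ≤ t) ∧ ∑ i ∈ H, y i = a ∧ ∑ i ∈ Hᶜ, y i = b}.ncard =
      boxCount {i // i ∈ H} t a * boxCount {i // i ∉ H} t b := by
  rw [boxCount, boxCount, ← Set.ncard_prod]
  have e1 : ∀ y : E → ℕ, ∑ i : {i // i ∈ H}, y i = ∑ i ∈ H, y i := fun y =>
    Finset.sum_coe_sort H y
  have e2 : ∀ y : E → ℕ, ∑ i : {i // i ∉ H}, y i = ∑ i ∈ Hᶜ, y i := fun y =>
    (Finset.sum_subtype Hᶜ (by simp) y).symm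
  refine Set.ncard_congr (fun y _ => Equiv.piEquivPiSubtypeProd (· ∈ H) (fun _ => ℕ) y) ?_ ?_ ?_
  · rintro y ⟨h, ha, hb⟩
    exact ⟨⟨fun i => h i, (e1 y).trans ha⟩, ⟨fun i => h i, (e2 y).trans hb⟩⟩
  · intro y z _ _ h
    exact (Equiv.piEquivPiSubtypeProd _ _).injective h
  · rintro p ⟨⟨h1, ha⟩, ⟨h2, hb⟩⟩
    obtain ⟨y, rfl⟩ := (Equiv.piEquivPiSubtypeProd (· ∈ H) (fun _ => ℕ)).surjective p
    refine ⟨y, ⟨fun i => ?_, (e1 y).symm.trans ha, (e2 y).symm.trans hb⟩, rfl⟩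
    by_cases hi : i ∈ H
    · exact h1 ⟨i, hi⟩
    · exact h2 ⟨i, hi⟩

theorem finite_setOf_le {E : Type*} [Finite E] (t : ℕ) : {y : E → ℕ | ∀ i, y i ≤ t}.Finite := by
  have : {y : E → ℕ | ∀ i, y i ≤ t} = Set.Iic (fun _ => t) := rfl
  rw [this]
  cases nonempty_fintype E
  classical
  exact Set.finite_Iic _

/-- The number of points of `{0, …, t}^E` with coordinate sum `r t` that violate the inequality
`y(H) ≤ (r - 1) t` of a `k`-set `H`. -/
def excessCount {E : Type*} [Fintype E] (H : Finset E) (r t : ℕ) : ℕ :=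
  {y : E → ℕ | (∀ i, y i ≤ t) ∧ ∑ i, y i = r * t ∧ (r - 1) * t < ∑ i ∈ H, y i}.ncard

/-- Sort the points by `j = y(Hᶜ)`: as the total is `r t`, the condition `y(H) > (r - 1) t` means `j
< t`. -/
theorem excessCount_eq_sum_boxCount {E : Type*} [Fintype E] [DecidableEq E] (H : Finset E) {r : ℕ}
    (hr : 1 ≤ r) (t : ℕ) :
    excessCount H r t = ∑ j ∈ Finset.range t,
      boxCount {i // i ∈ H} t (r * t - j) * boxCount {i // i ∉ H} t j := by
  obtain ⟨r, rfl⟩ := Nat.exists_eq_add_of_le' hr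
  have hfin : ∀ p : (E → ℕ) → Prop, {y : E → ℕ | (∀ i, y i ≤ t) ∧ p y}.Finite := fun p =>
    (finite_setOf_le t).subset fun y hy => hy.1
  have hsplit : ∀ y : E → ℕ, ∑ i ∈ H, y i + ∑ i ∈ Hᶜ, y i = ∑ i, y i := fun y =>
    Finset.sum_add_sum_compl H y
  have hmul : (r + 1) * t = r * t + t := by ring
  rw [excessCount, Set.ncard_eq_toFinset_card _ (hfin _), Finset.card_eq_sum_card_fiberwise
    (f := fun y => ∑ i ∈ Hᶜ, y i) (t := Finset.range t)]
  · refine Finset.sum_congr rfl fun j hj => ?_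
    rw [← ncard_sum_eq_and_sum_eq, ← Set.ncard_coe_finset]
    congr 1
    ext y
    have := hsplit y
    have hj' : j < t := by simpa using hj
    simp only [Finset.coe_filter, Set.Finite.mem_toFinset, Set.mem_ofPred_eq, Nat.add_sub_cancel]
    constructor
    · rintro ⟨⟨h1, h2, h3⟩, h4⟩
      exact ⟨h1, by omega, h4⟩
    · rintro ⟨h1, h2, h3⟩
      exact ⟨⟨h1, by omega, by omega⟩, h3⟩
  · intro y hy
    have := hsplit y
    simp only [Set.Finite.coe_toFinset, Set.mem_ofPred_eq, Nat.add_sub_cancel] at hy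
    simp only [Finset.coe_range, Set.mem_Iio]
    omega

/-- The term of inclusion-exclusion for the coordinate sum `d t + j`, as a binomial coefficient. -/
theorem ite_choose_eq {d i j t K : ℕ} (hi : i ≤ d) (hK : i ≤ K) :
    (if i * (t + 1) ≤ d * t + j then ((d * t + j - i * (t + 1) + K).choose K : ℚ) else 0) =
      (((d - i) * t + (K - i) + j).choose K : ℚ) := by
  obtain ⟨d, rfl⟩ := Nat.exists_eq_add_of_le hi
  obtain ⟨K, rfl⟩ := Nat.exists_eq_add_of_le hK
  have h1 : (i + d) * t = i * t + d * t := by ring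
  have h2 : i * (t + 1) = i * t + i := by ring
  have h3 : i + d - i = d := by omega
  have h4 : i + K - i = K := by omega
  rw [h1, h2, h3, h4]
  split_ifs with h
  · congr 2; omega
  -- The omitted terms agree with the formula because there the upper entry is smaller than `K`.
  · rw [Nat.choose_eq_zero_of_lt (by omega)]; simp

/-- Since `j < t`, the terms with `i > d` vanish: `(d + 1) (t + 1)` exceeds `d t + j`. The remaining
terms are binomials without a case distinction, hence polynomial in `t` and `j`. -/
theorem boxCount_mul_add (E : Type*) [Fintype E] (K : ℕ) (hK : Fintype.card E = K + 1) {d j t : ℕ}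
    (hd : d ≤ K) (hj : j < t) :
    (boxCount E t (d * t + j) : ℚ) = ∑ i ∈ Finset.range (d + 1),
      (-1 : ℚ) ^ i * ((K + 1).choose i : ℚ) * (((d - i) * t + (K - i) + j).choose K : ℚ) := by
  rw [boxCount_eq_sum E K hK, ← Finset.sum_subset (s₁ := Finset.range (d + 1))]
  · refine Finset.sum_congr rfl fun i hi => ?_
    have : i ≤ d := by simpa [Nat.lt_succ_iff] using hi
    rw [ite_choose_eq this (by omega)]
  · intro i; simp only [Finset.mem_range]; omega
  · intro i _ hi
    rw [if_neg, mul_zero]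
    have : (d + 1) * (t + 1) ≤ i * (t + 1) := Nat.mul_le_mul_right _ (by simpa using hi)
    have h2 : (d + 1) * (t + 1) = d * t + t + d + 1 := by ring
    omega

/-- With `k = N + 1` and `a = (k - r - i) t + (k - 1 - i)`, the other upper entry in `phiTilde` is
`a + t - 1 - l`. -/
theorem phiTilde_eval (r N m t : ℕ) (hr : 1 ≤ r) (hrN : r ≤ N + 1) :
    (phiTilde r (N + 1) (m + 1 + N + 1)).eval (t : ℚ) = ∑ i ∈ Finset.range (N + 2 - r),
      (-1 : ℚ) ^ i * ((N + 1).choose i : ℚ) *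
        innerSum (m + 1) N (((N + 1 - r - i) * t + (N - i) : ℕ) : ℚ) t := by
  rw [phiTilde, eval_finsetSum]
  refine Finset.sum_congr rfl fun i hi => ?_
  have hi' : i + r ≤ N + 1 := by have := Finset.mem_range.1 hi; omega
  have e1 : ((N + 1 - r - i : ℕ) : ℚ) = (N : ℚ) + 1 - r - i := by
    rw [Nat.sub_sub, Nat.cast_sub (by omega)]; push_cast; ring
  rcases Nat.lt_or_ge N i with hNi | hNi
  · omega
  have e2 : ((N - i : ℕ) : ℚ) = (N : ℚ) - i := Nat.cast_sub hNi
  rw [eval_mul, eval_C, eval_finsetSum, innerSum]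
  congr 1
  refine Finset.sum_congr rfl fun l hl => ?_
  rw [eval_mul, eval_mul, eval_C, eval_binomPoly, eval_binomPoly, Nat.add_sub_cancel,
    show m + 1 + N + 1 - 2 - l = m + 1 + N - 1 - l by omega]
  simp only [eval_add, eval_mul, eval_C, eval_X]
  push_cast
  rw [e1, e2]
  congr 2
  · congr 1
    ring
  · ring

/-- For `j < t` the bound `y i ≤ t` is vacuous off `H`, where the count is `(j + m choose m)` with
`m = n - k - 1`. On `H`, reflection and `boxCount_mul_add` give an alternating sum over `i`. After
exchanging the sums, `sum_choose_mul_ratChoose` evaluates each sum over `j`. -/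
theorem excessCount_eq_eval {E : Type*} [Fintype E] (H : Finset E) {r k n : ℕ} (hr : 1 ≤ r)
    (hrk : r - 1 ≤ k) (hkn : k < n) (hn : Fintype.card E = n) (hk : H.card = k) (t : ℕ) :
    (excessCount H r t : ℚ) = (C (((n : ℚ) - k) / ((n - 1).factorial : ℚ)) *
      binomPoly (X - 1 + C ((n : ℚ) - k)) (n - k) * phiTilde r k n).eval (t : ℚ) := by
  classical
  rcases Nat.lt_or_ge k r with h | hrk'
  -- For `k = r - 1` the bounds `y i ≤ t` already give `y(H) ≤ (r - 1) t`, matching the empty outer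
  -- sum.
  · rw [phiTilde, show k + 1 - r = 0 by omega, Finset.sum_range_zero, mul_zero, eval_zero]
    norm_cast
    rw [excessCount, show {y : E → ℕ | _} = ∅ from ?_, Set.ncard_empty]
    refine Set.eq_empty_of_forall_notMem ?_
    rintro y ⟨h1, -, h3⟩
    have : ∑ i ∈ H, y i ≤ H.card • t := Finset.sum_le_card_nsmul _ _ _ fun i _ => h1 i
    rw [hk, show k = r - 1 by omega, smul_eq_mul] at this
    omega
  obtain ⟨N, rfl⟩ : ∃ N, k = N + 1 := Nat.exists_eq_add_of_le' (by omega)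
  obtain ⟨m, rfl⟩ : ∃ m, n = m + 1 + N + 1 := ⟨n - N - 2, by omega⟩
  have hcH : Fintype.card {i // i ∈ H} = N + 1 := by rw [Fintype.card_coe, hk]
  have hcH' : Fintype.card {i // i ∉ H} = m + 1 := by
    rw [Fintype.card_subtype_compl, Fintype.card_coe, hk, hn]; omega
  have hbox : ∀ j ∈ Finset.range t,
      ((boxCount {i // i ∈ H} t (r * t - j) * boxCount {i // i ∉ H} t j : ℕ) : ℚ) =
      ∑ i ∈ Finset.range (N + 1 - r + 1), (-1 : ℚ) ^ i * ((N + 1).choose i : ℚ) *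
        (((j + m).choose m : ℚ) *
          ratChoose ((((N + 1 - r - i) * t + (N - i) : ℕ) : ℚ) + j) N) := by
    intro j hj
    have hj' : j < t := by simpa using hj
    have hle : t ≤ r * t := Nat.le_mul_of_pos_left t hr
    rw [boxCount_of_le {i // i ∉ H} m hcH' hj'.le,
      boxCount_compl {i // i ∈ H} (a := r * t - j) (b := (N + 1 - r) * t + j), Nat.cast_mul,
      boxCount_mul_add {i // i ∈ H} N hcH (by omega) hj', Finset.sum_mul]
    · refine Finset.sum_congr rfl fun i _ => ?_
      rw [← ratChoose_natCast ((N + 1 - r - i) * t + (N - i) + j)]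
      push_cast
      ring
    · obtain ⟨d, hd⟩ := Nat.exists_eq_add_of_le hrk'
      rw [hcH, hd, Nat.add_sub_cancel_left, add_mul]
      omega
  rw [excessCount_eq_sum_boxCount H hr, Nat.cast_sum, Finset.sum_congr rfl hbox,
    Finset.sum_comm, eval_mul, eval_mul, eval_C, eval_binomPoly, phiTilde_eval r N m t hr hrk',
    Finset.mul_sum, show N + 2 - r = N + 1 - r + 1 by omega]
  refine Finset.sum_congr rfl fun i _ => ?_
  rw [← Finset.mul_sum, sum_choose_mul_ratChoose, show m + 1 + N + 1 - (N + 1) = m + 1 by omega,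
    show m + 1 + N + 1 - 1 = m + 1 + N by omega]
  have e1 : (((m + 1 + N + 1 : ℕ) : ℚ) - ((N + 1 : ℕ) : ℚ)) = m + 1 := by push_cast; ring
  rw [e1]
  have e2 : eval (t : ℚ) (X - 1 + C ((m : ℚ) + 1)) = t + m := by
    simp
  rw [e2]
  ring

/-- The Ehrhart polynomial of the uniform matroid `U_{r,n}` as an alternating sum. -/
def uniformEhrhart (r n : ℕ) : ℚ[X] :=
  ∑ i ∈ Finset.range r, C ((-1 : ℚ) ^ i * (n.choose i : ℚ)) *
    binomPoly (C ((r : ℚ) - i) * X + C ((n : ℚ) - 1 - i)) (n - 1)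

/-- Inclusion-exclusion for the sum `r t` stops before `i = r`, because `r (t + 1) > r t`. -/
theorem uniformEhrhart_eval (E : Type*) [Fintype E] {r n : ℕ} (hn : Fintype.card E = n)
    (hr : 1 ≤ r) (hrn : r ≤ n) (t : ℕ) :
    (uniformEhrhart r n).eval (t : ℚ) = boxCount E t (r * t) := by
  obtain ⟨N, rfl⟩ : ∃ N, n = N + 1 := Nat.exists_eq_add_of_le' (by omega)
  rw [boxCount_eq_sum E N hn, uniformEhrhart, eval_finsetSum,
    ← Finset.sum_subset (s₁ := Finset.range r) (s₂ := Finset.range (N + 2))]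
  · refine Finset.sum_congr rfl fun i hi => ?_
    have hir : i < r := by simpa using hi
    have h := ite_choose_eq (d := r) (i := i) (j := 0) (t := t) (K := N) hir.le (by omega)
    simp only [add_zero] at h
    rw [h, eval_mul, eval_C, eval_binomPoly, Nat.add_sub_cancel,
      ← ratChoose_natCast ((r - i) * t + (N - i))]
    congr 2
    push_cast [Nat.cast_sub hir.le, Nat.cast_sub (show i ≤ N by omega)]
    simp
  · intro i; simp only [Finset.mem_range]; omega
  · intro i _ hi
    rw [Finset.mem_range, not_lt] at hi
    by_cases h : i * (t + 1) ≤ r * t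
    · exfalso
      have : r * (t + 1) ≤ i * (t + 1) := Nat.mul_le_mul_right _ hi
      have h2 : r * (t + 1) = r * t + r := by ring
      omega
    · rw [if_neg h, mul_zero]

/-! ### The inequality description of the base polytope -/

/-- The polytope cut out of the hypersimplex by the inequalities `x(H) ≤ r - 1`, `H ∈ 𝓗`. -/
def blockPolytope {E : Type*} [Fintype E] (𝓗 : Set (Finset E)) (r : ℕ) : Set (E → ℝ) :=
  {x | (∀ i, 0 ≤ x i ∧ x i ≤ 1) ∧ ∑ i, x i = r ∧ ∀ H ∈ 𝓗, ∑ i ∈ H, x i ≤ (r : ℝ) - 1}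

section

variable {E : Type*} [Fintype E] {𝓗 : Set (Finset E)} {r : ℕ}

theorem convex_blockPolytope : Convex ℝ (blockPolytope 𝓗 r) := by
  rintro x ⟨hx, hxs, hxH⟩ y ⟨hy, hys, hyH⟩ a b ha hb hab
  have hsum : ∀ s : Finset E, ∑ i ∈ s, (a • x + b • y) i = a * ∑ i ∈ s, x i + b * ∑ i ∈ s, y i := by
    intro s
    simp [Finset.sum_add_distrib, Finset.mul_sum]
  refine ⟨fun i => ⟨?_, ?_⟩, ?_, fun H hH => ?_⟩
  · have := (hx i).1; have := (hy i).1
    simp only [Pi.add_apply, Pi.smul_apply, smul_eq_mul]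
    positivity
  · have := mul_le_mul_of_nonneg_left (hx i).2 ha
    have := mul_le_mul_of_nonneg_left (hy i).2 hb
    simp only [Pi.add_apply, Pi.smul_apply, smul_eq_mul]
    linarith
  · rw [hsum, hxs, hys, ← add_mul, hab, one_mul]
  · have := mul_le_mul_of_nonneg_left (hxH H hH) ha
    have := mul_le_mul_of_nonneg_left (hyH H hH) hb
    rw [hsum]
    calc _ ≤ a * ((r : ℝ) - 1) + b * ((r : ℝ) - 1) := by linarith
      _ = (r : ℝ) - 1 := by rw [← add_mul, hab, one_mul]

theorem isClosed_blockPolytope : IsClosed (blockPolytope 𝓗 r) := by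
  simp only [blockPolytope, Set.ofPred_and, Set.ofPred_forall]
  refine IsClosed.inter (isClosed_iInter fun i => IsClosed.inter ?_ ?_)
    (IsClosed.inter ?_ (isClosed_iInter fun H => isClosed_iInter fun _ => ?_))
  · exact isClosed_le continuous_const (continuous_apply i)
  · exact isClosed_le (continuous_apply i) continuous_const
  · exact isClosed_eq (by fun_prop) continuous_const
  · exact isClosed_le (by fun_prop) continuous_const

theorem isCompact_blockPolytope : IsCompact (blockPolytope 𝓗 r) := by
  refine (isCompact_univ_pi fun _ : E => isCompact_Icc (a := (0 : ℝ)) (b := 1)).of_isClosed_subset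
    isClosed_blockPolytope ?_
  rintro x ⟨hx, -⟩ i -
  exact hx i

/-- If no tight inequality separates the fractional coordinates `a` and `b` of a point, then the
point can be moved both ways in the direction `e_a - e_b`. -/
theorem not_mem_extremePoints_of_unseparated [DecidableEq E] {x : E → ℝ}
    (hx : x ∈ blockPolytope 𝓗 r) {a b : E} (hab : a ≠ b) (ha : 0 < x a ∧ x a < 1)
    (hb : 0 < x b ∧ x b < 1)
    (h : ∀ H ∈ 𝓗, ∑ i ∈ H, x i = (r : ℝ) - 1 → (a ∈ H ↔ b ∈ H)) :
    x ∉ (blockPolytope 𝓗 r).extremePoints ℝ := by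
  obtain ⟨hx1, hxs, hxH⟩ := hx
  set d : E → ℝ := Pi.single a 1 - Pi.single b 1 with hd
  have hsum : ∀ (s : Finset E) (ε : ℝ), ∑ i ∈ s, (x + ε • d) i =
      ∑ i ∈ s, x i + ε * ((if a ∈ s then 1 else 0) - if b ∈ s then 1 else 0) := by
    intro s ε
    simp [Finset.sum_add_distrib, hd, ← Finset.mul_sum, Finset.sum_pi_single']
  have hcont : ∀ i, Continuous fun ε : ℝ => (x + ε • d) i := fun i => by
    simp only [Pi.add_apply, Pi.smul_apply, smul_eq_mul]; fun_prop
  have hz : ∀ i, (x + (0 : ℝ) • d) i = x i := fun i => by simp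
  -- Constraints that are strict at `x` survive a small move. Coordinates equal to 0 or 1 are not
  -- moved, and a tight block contains both or neither of `a`, `b`, so its sum is unchanged.
  have hev : ∀ᶠ ε in nhds (0 : ℝ), x + ε • d ∈ blockPolytope 𝓗 r := by
    have h1 : ∀ᶠ ε in nhds (0 : ℝ), ∀ i, 0 ≤ (x + ε • d) i ∧ (x + ε • d) i ≤ 1 := by
      rw [Filter.eventually_all]
      intro i
      by_cases hi : 0 < x i ∧ x i < 1
      · have l1 := ((hcont i).tendsto 0).eventually_const_lt (u := 0) (by rw [hz]; exact hi.1)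
        have l2 := ((hcont i).tendsto 0).eventually_lt_const (u := 1) (by rw [hz]; exact hi.2)
        filter_upwards [l1, l2] with ε e1 e2 using ⟨e1.le, e2.le⟩
      · have hia : i ≠ a := by rintro rfl; exact hi ha
        have hib : i ≠ b := by rintro rfl; exact hi hb
        refine Filter.Eventually.of_forall fun ε => ?_
        simpa [hd, hia, hib] using hx1 i
    have h2 : ∀ᶠ ε in nhds (0 : ℝ), ∀ H : Finset E, H ∈ 𝓗 → ∑ i ∈ H, (x + ε • d) i ≤ (r : ℝ) - 1 := by
      rw [Filter.eventually_all]
      intro H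
      by_cases hH : H ∈ 𝓗
      · rcases (hxH H hH).eq_or_lt with heq | hlt
        · refine Filter.Eventually.of_forall fun ε _ => ?_
          have := h H hH heq
          rw [hsum]
          by_cases haH : a ∈ H
          · simp [haH, this.1 haH, heq]
          · simp [haH, mt this.2 haH, heq]
        · have hc : Continuous fun ε : ℝ => ∑ i ∈ H, (x + ε • d) i :=
            continuous_finsetSum _ fun i _ => hcont i
          have l1 := (hc.tendsto 0).eventually_lt_const (u := (r : ℝ) - 1)
            (by simp only [hz]; exact hlt)
          filter_upwards [l1] with ε e1 _ using e1.le
      · exact Filter.Eventually.of_forall fun ε h' => absurd h' hH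
    filter_upwards [h1, h2] with ε e1 e2
    refine ⟨e1, ?_, e2⟩
    rw [hsum]
    simp [hxs]
  obtain ⟨δ, hδ, hball⟩ := Metric.eventually_nhds_iff.1 hev
  have hp : x + (δ / 2) • d ∈ blockPolytope 𝓗 r := hball (by
    rw [Real.dist_eq, sub_zero, abs_of_pos (by positivity)]; linarith)
  have hn : x + (-(δ / 2)) • d ∈ blockPolytope 𝓗 r := hball (by
    rw [Real.dist_eq, sub_zero, abs_neg, abs_of_pos (by positivity)]; linarith)
  intro hext
  have := (mem_extremePoints_iff_left.1 hext).2 _ hp _ hn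
    ⟨1 / 2, 1 / 2, by norm_num, by norm_num, by norm_num, by module⟩
  have h3 := congrFun this a
  simp [hd, hab] at h3
  linarith

/-- A sum of numbers of `[0, 1]` with exactly one fractional summand is not an integer. -/
theorem exists_ne_fractional {E : Type*} {x : E → ℝ} (hx : ∀ i, 0 ≤ x i ∧ x i ≤ 1) {G : Finset E} {N : ℤ}
    (hG : ∑ i ∈ G, x i = N) {c : E} (hcG : c ∈ G) (hc : 0 < x c ∧ x c < 1) :
    ∃ b ∈ G, b ≠ c ∧ 0 < x b ∧ x b < 1 := by
  classical
  by_contra! hcon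
  have hint : ∀ i ∈ G.erase c, x i = ((if x i = 0 then 0 else 1 : ℤ) : ℝ) := by
    intro i hi
    rw [Finset.mem_erase] at hi
    by_cases h0 : x i = 0
    · simp [h0]
    · have := hcon i hi.2 hi.1 (lt_of_le_of_ne (hx i).1 (Ne.symm h0))
      simp [le_antisymm (hx i).2 this]
  rw [← Finset.add_sum_erase _ _ hcG, Finset.sum_congr rfl hint, ← Int.cast_sum] at hG
  obtain ⟨h0, h1⟩ := hc
  have hxc : x c = ((N - ∑ i ∈ G.erase c, if x i = 0 then 0 else 1 : ℤ) : ℝ) := by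
    rw [Int.cast_sub]; linarith
  rw [hxc] at h0 h1
  have h0' := Int.cast_pos.1 h0
  have h1' := Int.cast_lt.1 (h1.trans_eq Int.cast_one.symm)
  omega

/-- If two distinct blocks `H`, `H₀` are tight, then `x(H ∪ H₀) + x(H ∩ H₀) = 2 r - 2`, while the
summands are at most `r` and `r - 2`. Both bounds are attained, so `x` is 1 on `H ∩ H₀` and 0 off `H
∪ H₀`, and every fractional coordinate lies in exactly one of the two blocks. Thus all tight blocks
split the fractional coordinates in the same way. The side `G` of this split that contains `c` (`H₀`
or its complement, or all of `E` if nothing is tight) has an integral sum, hence a second fractional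
coordinate that no tight block separates from `c`. -/
theorem extremePoints_blockPolytope_integral [DecidableEq E]
    (h𝓗 : ∀ H ∈ 𝓗, ∀ H' ∈ 𝓗, H ≠ H' → (H ∩ H').card + 2 ≤ r) {x : E → ℝ}
    (hx : x ∈ (blockPolytope 𝓗 r).extremePoints ℝ) (c : E) : x c = 0 ∨ x c = 1 := by
  obtain ⟨hx1, hxs, hxH⟩ := hx.1
  by_contra! hcon
  have hc : 0 < x c ∧ x c < 1 :=
    ⟨lt_of_le_of_ne (hx1 c).1 hcon.1.symm, lt_of_le_of_ne (hx1 c).2 hcon.2⟩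
  obtain ⟨G, N, hG, hcG, hsep⟩ : ∃ (G : Finset E) (N : ℤ), ∑ i ∈ G, x i = N ∧ c ∈ G ∧
      ∀ b ∈ G, 0 < x b ∧ x b < 1 → ∀ H ∈ 𝓗, ∑ i ∈ H, x i = (r : ℝ) - 1 → (c ∈ H ↔ b ∈ H) := by
    by_cases htight : ∃ H₀ ∈ 𝓗, ∑ i ∈ H₀, x i = (r : ℝ) - 1
    · obtain ⟨H₀, hH₀, hs₀⟩ := htight
      have hpart : ∀ b, 0 < x b ∧ x b < 1 → ∀ H ∈ 𝓗, ∑ i ∈ H, x i = (r : ℝ) - 1 → H ≠ H₀ →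
          (b ∈ H ↔ b ∉ H₀) := by
        intro b hb H hH hs hne
        have hcard : ((H ∩ H₀).card : ℝ) + 2 ≤ r := by exact_mod_cast h𝓗 H hH H₀ hH₀ hne
        have hui := Finset.sum_union_inter (s₁ := H) (s₂ := H₀) (f := x)
        have hinter : ∑ i ∈ H ∩ H₀, x i ≤ (H ∩ H₀).card := by
          simpa using Finset.sum_le_card_nsmul (H ∩ H₀) x 1 fun i _ => (hx1 i).2
        have hunion : ∑ i ∈ H ∪ H₀, x i ≤ r := by
          rw [← hxs]
          exact Finset.sum_le_univ_sum_of_nonneg fun i => (hx1 i).1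
        constructor
        · intro hbH hbH₀
          have : ∑ i ∈ H ∩ H₀, x i < ∑ i ∈ H ∩ H₀, 1 :=
            Finset.sum_lt_sum (fun i _ => (hx1 i).2) ⟨b, Finset.mem_inter.2 ⟨hbH, hbH₀⟩, hb.2⟩
          rw [Finset.sum_const, nsmul_eq_mul, mul_one] at this
          linarith
        · intro hbH₀
          by_contra hbH
          have : ∑ i ∈ H ∪ H₀, x i < ∑ i, x i :=
            Finset.sum_lt_sum_of_subset (Finset.subset_univ _) (Finset.mem_univ b)
              (by simp [hbH, hbH₀]) hb.1 fun i _ _ => (hx1 i).1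
          linarith
      have main : ∀ b, 0 < x b ∧ x b < 1 → (c ∈ H₀ ↔ b ∈ H₀) → ∀ H ∈ 𝓗,
          ∑ i ∈ H, x i = (r : ℝ) - 1 → (c ∈ H ↔ b ∈ H) := by
        intro b hb hiff H hH hs
        by_cases hne : H = H₀
        · rw [hne, hiff]
        · rw [hpart b hb H hH hs hne, hpart c hc H hH hs hne, hiff]
      by_cases hcH : c ∈ H₀
      · exact ⟨H₀, (r : ℤ) - 1, by push_cast; exact hs₀, hcH, fun b hbG hb =>
          main b hb (iff_of_true hcH hbG)⟩
      · refine ⟨H₀ᶜ, 1, ?_, Finset.mem_compl.2 hcH, fun b hbG hb =>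
          main b hb (iff_of_false hcH (Finset.mem_compl.1 hbG))⟩
        have := Finset.sum_add_sum_compl H₀ x
        push_cast
        linarith
    · push Not at htight
      exact ⟨Finset.univ, r, by simpa using hxs, Finset.mem_univ c, fun b _ _ H hH hs =>
        absurd hs (htight H hH)⟩
  obtain ⟨b, hbG, hbc, hb⟩ := exists_ne_fractional hx1 hG hcG hc
  exact not_mem_extremePoints_of_unseparated hx.1 hbc.symm hc hb (hsep b hbG hb) hx

/-- By Krein–Milman the cut polytope is the closed hull of its extreme points. These are 0/1 vectors
of sum `r`, that is, indicators of `r`-sets, and `x(H) ≤ r - 1` says that such a set is not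
contained in `H`. -/
theorem convexHull_indicator_eq_blockPolytope
    (h𝓗 : ∀ H ∈ 𝓗, ∀ H' ∈ 𝓗, H ≠ H' → ∀ T : Finset E, T.card + 1 = r → T ⊆ H → ¬ T ⊆ H')
    (hr : 1 ≤ r) :
    convexHull ℝ ((fun B : Set E => B.indicator (fun _ => (1 : ℝ))) ''
      {B | B.ncard = r ∧ ∀ H ∈ 𝓗, ¬ B ⊆ (H : Set E)}) = blockPolytope 𝓗 r := by
  classical
  have h𝓗' : ∀ H ∈ 𝓗, ∀ H' ∈ 𝓗, H ≠ H' → (H ∩ H').card + 2 ≤ r := by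
    intro H hH H' hH' hne
    by_contra hlt
    obtain ⟨T, hT, hTc⟩ := Finset.exists_subset_card_eq (s := H ∩ H') (n := r - 1) (by omega)
    exact h𝓗 H hH H' hH' hne T (by omega) (hT.trans Finset.inter_subset_left)
      (hT.trans Finset.inter_subset_right)
  have hind : ∀ (B s : Finset E), ∑ i ∈ s, (B : Set E).indicator (fun _ => (1 : ℝ)) i =
      ((s ∩ B).card : ℝ) := by
    intro B s
    simp [Set.indicator_apply]
  apply Set.Subset.antisymm
  · refine convexHull_min ?_ convex_blockPolytope
    rintro _ ⟨B, ⟨hB, hBH⟩, rfl⟩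
    lift B to Finset E using Set.toFinite B
    rw [Set.ncard_coe_finset] at hB
    refine ⟨fun i => ?_, ?_, fun H hH => ?_⟩
    · by_cases hi : i ∈ B <;> simp [hi]
    · change ∑ i, (B : Set E).indicator (fun _ => (1 : ℝ)) i = r
      rw [hind, Finset.univ_inter, hB]
    · change ∑ i ∈ H, (B : Set E).indicator (fun _ => (1 : ℝ)) i ≤ r - 1
      have : (H ∩ B).card < B.card := by
        refine Finset.card_lt_card ⟨Finset.inter_subset_right, fun h => hBH H hH ?_⟩
        exact fun i hi => Finset.mem_of_mem_inter_left (h hi)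
      rw [hind, le_sub_iff_add_le]
      exact_mod_cast (by omega : (H ∩ B).card + 1 ≤ r)
  · conv_lhs => rw [← closure_convexHull_extremePoints isCompact_blockPolytope
      convex_blockPolytope]
    refine closure_minimal (convexHull_mono ?_) ((Set.toFinite _).isClosed_convexHull ℝ)
    intro x hx
    have hx01 := extremePoints_blockPolytope_integral h𝓗' hx
    obtain ⟨hx1, hxs, hxH⟩ := hx.1
    set B : Finset E := Finset.univ.filter fun i => x i = 1 with hBdef
    have hxB : (B : Set E).indicator (fun _ => (1 : ℝ)) = x := by
      funext i
      rcases hx01 i with h | h <;> simp [hBdef, h]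
    refine ⟨B, ⟨?_, fun H hH hBH => ?_⟩, hxB⟩
    · rw [← hxB, hind, Finset.univ_inter] at hxs
      rw [Set.ncard_coe_finset]
      exact_mod_cast hxs
    · have h1 := hxH H hH
      have h2 := hxs
      rw [← hxB, hind] at h1 h2
      rw [Finset.univ_inter] at h2
      rw [Finset.inter_eq_right.2 (Finset.coe_subset.1 hBH)] at h1
      linarith

end

/-! ### Lattice points of the dilated base polytope -/

section

variable {E : Type*} [Fintype E] {𝓗 : Set (Finset E)} {r : ℕ}

/-- Nonemptiness matters at `t = 0`: `0 • ∅` is empty, but the origin satisfies the scaled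
inequalities. -/
theorem mem_smul_blockPolytope_iff (hne : (blockPolytope 𝓗 r).Nonempty) (t : ℕ) (x : E → ℝ) :
    x ∈ (t : ℝ) • blockPolytope 𝓗 r ↔ (∀ i, 0 ≤ x i ∧ x i ≤ t) ∧ ∑ i, x i = r * t ∧
      ∀ H ∈ 𝓗, ∑ i ∈ H, x i ≤ ((r : ℝ) - 1) * t := by
  rcases Nat.eq_zero_or_pos t with rfl | ht
  · rw [Nat.cast_zero, Set.zero_smul_set hne, Set.mem_zero]
    constructor
    · rintro rfl
      simp
    · rintro ⟨h, -⟩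
      funext i
      exact le_antisymm (h i).2 (h i).1
  · have ht' : (0 : ℝ) < t := by exact_mod_cast ht
    have hsum : ∀ s : Finset E, ∑ i ∈ s, ((t : ℝ)⁻¹ • x) i = (∑ i ∈ s, x i) / t := fun s => by
      simp [div_eq_inv_mul, Finset.mul_sum]
    rw [Set.mem_smul_set_iff_inv_smul_mem₀ ht'.ne', blockPolytope, Set.mem_ofPred_eq]
    refine and_congr (forall_congr' fun i => ?_) (and_congr ?_ (forall₂_congr fun H _ => ?_))
    · rw [Pi.smul_apply, smul_eq_mul, ← div_eq_inv_mul, div_le_one ht', le_div_iff₀ ht', zero_mul]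
    · rw [hsum, div_eq_iff ht'.ne']
    · rw [hsum, div_le_iff₀ ht']

theorem ehrhartFunction_blockPolytope (hne : (blockPolytope 𝓗 r).Nonempty) (hr : 1 ≤ r) (t : ℕ) :
    ehrhartFunction (blockPolytope 𝓗 r) t =
      {y : E → ℕ | (∀ i, y i ≤ t) ∧ ∑ i, y i = r * t ∧
        ∀ H ∈ 𝓗, ∑ i ∈ H, y i ≤ (r - 1) * t}.ncard := by
  have key : ∀ y : E → ℕ, (fun i => ((y i : ℤ) : ℝ)) ∈ (t : ℝ) • blockPolytope 𝓗 r ↔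
      (∀ i, y i ≤ t) ∧ ∑ i, y i = r * t ∧ ∀ H ∈ 𝓗, ∑ i ∈ H, y i ≤ (r - 1) * t := by
    intro y
    rw [mem_smul_blockPolytope_iff hne]
    have hr' : (r : ℝ) - 1 = ((r - 1 : ℕ) : ℝ) := by rw [Nat.cast_sub hr, Nat.cast_one]
    rw [hr']
    refine and_congr (forall_congr' fun i => ?_) (and_congr ?_ (forall₂_congr fun H _ => ?_))
    · simp
    · norm_cast
    · norm_cast
  symm
  refine Set.ncard_congr (fun y _ i => (y i : ℤ)) (fun y hy => (key y).2 hy) ?_ ?_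
  · intro y z _ _ h
    funext i
    exact Int.ofNat.inj (congrFun h i)
  · intro z hz
    have hz0 : ∀ i, 0 ≤ z i := fun i => by
      have := ((mem_smul_blockPolytope_iff hne t _).1 hz).1 i
      exact_mod_cast this.1
    have hzz : (fun i => ((z i).toNat : ℤ)) = z := funext fun i => Int.toNat_of_nonneg (hz0 i)
    refine ⟨fun i => (z i).toNat, (key _).1 ?_, hzz⟩
    rw [← hzz] at hz
    exact hz

/-- No point violates two block inequalities: `y(H) + y(H') ≤ r t + (r - 2) t = 2 (r - 1) t` since
`|H ∩ H'| ≤ r - 2`. The violating points are therefore a disjoint union over the blocks. -/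
theorem boxCount_eq_ehrhartFunction_add (𝓕 : Finset (Finset E))
    (h𝓕 : ∀ H ∈ 𝓕, ∀ H' ∈ 𝓕, H ≠ H' → ∀ T : Finset E, T.card + 1 = r → T ⊆ H → ¬ T ⊆ H')
    (hne : (blockPolytope (𝓕 : Set (Finset E)) r).Nonempty) (hr : 1 ≤ r) (t : ℕ) :
    boxCount E t (r * t) =
      ehrhartFunction (blockPolytope (𝓕 : Set (Finset E)) r) t + ∑ H ∈ 𝓕, excessCount H r t := by
  classical
  rw [ehrhartFunction_blockPolytope hne hr]
  obtain ⟨r, rfl⟩ := Nat.exists_eq_add_of_le' hr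
  simp only [Nat.add_sub_cancel, excessCount, boxCount]
  have hfin : {y : E → ℕ | (∀ i, y i ≤ t) ∧ ∑ i, y i = (r + 1) * t}.Finite :=
    (finite_setOf_le t).subset fun y hy => hy.1
  set F := hfin.toFinset with hF
  have hmem : ∀ y, y ∈ F ↔ (∀ i, y i ≤ t) ∧ ∑ i, y i = (r + 1) * t := fun y => by simp [hF]
  have e0 : {y : E → ℕ | (∀ i, y i ≤ t) ∧ ∑ i, y i = (r + 1) * t} = F := by simp [hF]
  have e1 : {y : E → ℕ | (∀ i, y i ≤ t) ∧ ∑ i, y i = (r + 1) * t ∧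
      ∀ H ∈ (𝓕 : Set (Finset E)), ∑ i ∈ H, y i ≤ r * t} =
      (F.filter fun y => ∀ H ∈ 𝓕, ∑ i ∈ H, y i ≤ r * t : Finset (E → ℕ)) := by
    ext y
    simp [hmem, and_assoc]
  have e2 : ∀ H, {y : E → ℕ | (∀ i, y i ≤ t) ∧ ∑ i, y i = (r + 1) * t ∧ r * t < ∑ i ∈ H, y i} =
      (F.filter fun y => r * t < ∑ i ∈ H, y i : Finset (E → ℕ)) := by
    intro H
    ext y
    simp [hmem, and_assoc]
  have e3 : (F.filter fun y => ¬ ∀ H ∈ 𝓕, ∑ i ∈ H, y i ≤ r * t) =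
      𝓕.biUnion fun H => F.filter fun y => r * t < ∑ i ∈ H, y i := by
    ext y
    simp only [Finset.mem_filter, Finset.mem_biUnion, not_forall, not_le]
    tauto
  rw [e0, e1]
  simp only [e2, Set.ncard_coe_finset]
  rw [← Finset.card_filter_add_card_filter_not (fun y => ∀ H ∈ 𝓕, ∑ i ∈ H, y i ≤ r * t), e3,
    Finset.card_biUnion]
  intro H hH H' hH' hne'
  rw [Function.onFun, Finset.disjoint_left]
  intro y hy hy'
  rw [Finset.mem_filter, hmem] at hy hy'
  have hcard : (H ∩ H').card + 1 ≤ r := by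
    by_contra hlt
    obtain ⟨T, hT, hTc⟩ := Finset.exists_subset_card_eq (s := H ∩ H') (n := r) (by omega)
    exact h𝓕 H hH H' hH' hne' T (by omega) (hT.trans Finset.inter_subset_left)
      (hT.trans Finset.inter_subset_right)
  have hui := Finset.sum_union_inter (s₁ := H) (s₂ := H') (f := y)
  have hinter : ∑ i ∈ H ∩ H', y i ≤ (H ∩ H').card • t :=
    Finset.sum_le_card_nsmul _ _ _ fun i _ => hy.1.1 i
  have hunion : ∑ i ∈ H ∪ H', y i ≤ ∑ i, y i :=
    Finset.sum_le_sum_of_subset (Finset.subset_univ _)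
  have h3 : ((H ∩ H').card + 1) * t ≤ r * t := Nat.mul_le_mul_right _ hcard
  rw [smul_eq_mul] at hinter
  rw [hy.1.2] at hunion
  have h4 := hy.2
  have h5 := hy'.2
  rw [add_mul] at h3 hunion
  omega

end

/-! ### Ehrhart polynomials of uniform and Steiner system matroids -/

section

variable {E : Type*} [Fintype E] {r k n : ℕ} (S : SteinerSystem E (r - 1) k n)

theorem SteinerSystem.block_eq_of_subset {H H' T : Finset E} (hr : 1 ≤ r) (hH : H ∈ S.blocks)
    (hH' : H' ∈ S.blocks) (hT : T.card + 1 = r) (hTH : T ⊆ H) (hTH' : T ⊆ H') : H = H' :=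
  (S.existsUnique_block T (by omega)).unique ⟨hH, hTH⟩ ⟨hH', hTH'⟩

/-- The `(r - 1)`-subsets of the blocks partition the `(r - 1)`-subsets of `E`. -/
theorem SteinerSystem.card_blocks_mul {𝓕 : Finset (Finset E)}
    (h𝓕 : (𝓕 : Set (Finset E)) = S.blocks) :
    𝓕.card * k.choose (r - 1) = n.choose (r - 1) := by
  classical
  have hmem : ∀ H, H ∈ 𝓕 ↔ H ∈ S.blocks := fun H => by rw [← h𝓕, Finset.mem_coe]
  have hU : (Finset.univ : Finset E).powersetCard (r - 1) =
      𝓕.biUnion fun H => H.powersetCard (r - 1) := by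
    ext T
    simp only [Finset.mem_powersetCard, Finset.mem_biUnion, Finset.subset_univ, true_and]
    constructor
    · intro hT
      obtain ⟨H, ⟨hH, hTH⟩, -⟩ := S.existsUnique_block T hT
      exact ⟨H, (hmem H).2 hH, hTH, hT⟩
    · rintro ⟨H, -, -, hT⟩
      exact hT
  have hc := congrArg Finset.card hU
  rw [Finset.card_powersetCard, Finset.card_univ, S.card_ground, Finset.card_biUnion,
    Finset.sum_congr rfl fun H hH => by rw [Finset.card_powersetCard, S.card_block H ((hmem H).1 hH)],
    Finset.sum_const, smul_eq_mul] at hc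
  · exact hc.symm
  · intro H hH H' hH' hne
    rw [Function.onFun, Finset.disjoint_left]
    intro T hT hT'
    rw [Finset.mem_powersetCard] at hT hT'
    exact hne ((S.existsUnique_block T hT.2).unique ⟨(hmem H).1 hH, hT.1⟩
      ⟨(hmem H').1 hH', hT'.1⟩)

theorem SteinerSystem.basePolytope_matroid (hr : 1 ≤ r) (hrk : r - 1 ≤ k) (hkn : k < n) :
    (S.matroid hr hrk hkn).basePolytope = blockPolytope S.blocks r := by
  rw [← convexHull_indicator_eq_blockPolytope (fun H hH H' hH' hne T hT hTH hTH' =>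
    hne (S.block_eq_of_subset hr hH hH' hT hTH hTH')) hr]
  rfl

theorem SteinerSystem.basePolytope_nonempty (hr : 1 ≤ r) (hrk : r - 1 ≤ k) (hkn : k < n) :
    (S.matroid hr hrk hkn).basePolytope.Nonempty := by
  obtain ⟨B, hB⟩ := (S.matroid hr hrk hkn).exists_isBase
  exact ⟨_, subset_convexHull _ _ ⟨B, hB, rfl⟩⟩

theorem uniformMatroid_basePolytope (r n : ℕ) (h : r ≤ n) (hr : 1 ≤ r) :
    (uniformMatroid r n h).basePolytope = blockPolytope ∅ r := by
  rw [← convexHull_indicator_eq_blockPolytope (by simp) hr]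
  simp only [Set.mem_empty_iff_false, false_imp_iff, implies_true, and_true]
  rfl

/-- The case of an empty family of blocks, where no point is removed. -/
theorem isEhrhartPolynomial_uniformMatroid (r n : ℕ) (h : r ≤ n) (hr : 1 ≤ r) :
    IsEhrhartPolynomial (uniformMatroid r n h).basePolytope (uniformEhrhart r n) := by
  intro t
  have hne : (uniformMatroid r n h).basePolytope.Nonempty := by
    obtain ⟨B, hB⟩ := (uniformMatroid r n h).exists_isBase
    exact ⟨_, subset_convexHull _ _ ⟨B, hB, rfl⟩⟩
  rw [uniformMatroid_basePolytope r n h hr] at hne ⊢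
  rw [uniformEhrhart_eval (Fin n) (by simp) hr h, ← Finset.coe_empty,
    boxCount_eq_ehrhartFunction_add ∅ (by simp) (by rwa [Finset.coe_empty]) hr]
  simp

theorem SteinerSystem.isEhrhartPolynomial_matroid (hr : 1 ≤ r) (hrk : r - 1 ≤ k) (hkn : k < n) :
    IsEhrhartPolynomial (S.matroid hr hrk hkn).basePolytope
      (uniformEhrhart r n - C ((n.choose (r - 1) : ℚ) / (k.choose (r - 1) : ℚ)) *
        C (((n : ℚ) - k) / ((n - 1).factorial : ℚ)) *
        binomPoly (X - 1 + C ((n : ℚ) - k)) (n - k) * phiTilde r k n) := by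
  intro t
  have hne := S.basePolytope_nonempty hr hrk hkn
  rw [S.basePolytope_matroid] at hne ⊢
  obtain ⟨𝓕, h𝓕⟩ : ∃ 𝓕 : Finset (Finset E), (𝓕 : Set (Finset E)) = S.blocks :=
    ⟨(Set.toFinite S.blocks).toFinset, by simp⟩
  rw [← h𝓕] at hne ⊢
  have hmem : ∀ H, H ∈ 𝓕 ↔ H ∈ S.blocks := fun H => by rw [← h𝓕, Finset.mem_coe]
  have hbox := boxCount_eq_ehrhartFunction_add 𝓕 (fun H hH H' hH' hne T hT hTH hTH' =>
    hne (S.block_eq_of_subset hr ((hmem H).1 hH) ((hmem H').1 hH') hT hTH hTH')) hne hr t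
  have hexc : ∀ H ∈ 𝓕, (excessCount H r t : ℚ) = _ := fun H hH =>
    excessCount_eq_eval H hr hrk hkn S.card_ground (S.card_block H ((hmem H).1 hH)) t
  have hcard : (n.choose (r - 1) : ℚ) / (k.choose (r - 1) : ℚ) = 𝓕.card := by
    rw [← S.card_blocks_mul h𝓕, Nat.cast_mul, mul_div_cancel_right₀]
    exact_mod_cast (Nat.choose_pos hrk).ne'
  rw [hcard, eval_sub, uniformEhrhart_eval E S.card_ground hr (by omega), hbox, Nat.cast_add,
    Nat.cast_sum, Finset.sum_congr rfl hexc, Finset.sum_const, nsmul_eq_mul]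
  simp only [eval_mul, eval_C]
  ring

end

/-! ### The paving matroid of a Steiner system -/

section

variable {E : Type*} [Fintype E] {r k n : ℕ} (S : SteinerSystem E (r - 1) k n)

theorem SteinerSystem.matroid_isBase_iff (hr : 1 ≤ r) (hrk : r - 1 ≤ k) (hkn : k < n) (B : Set E) :
    (S.matroid hr hrk hkn).IsBase B ↔ S.IsMatroidBase r B := Iff.rfl

theorem SteinerSystem.matroid_E (hr : 1 ≤ r) (hrk : r - 1 ≤ k) (hkn : k < n) :
    (S.matroid hr hrk hkn).E = Set.univ := rfl

theorem SteinerSystem.matroid_eRank (hr : 1 ≤ r) (hrk : r - 1 ≤ k) (hkn : k < n) :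
    (S.matroid hr hrk hkn).eRank = (r : ℕ∞) := by
  obtain ⟨B, hB⟩ := (S.matroid hr hrk hkn).exists_isBase
  rw [← hB.encard_eq_eRank, ← hB.1, (Set.toFinite B).cast_ncard_eq]

/-- An `(r - 1)`-set spans the block that contains it: adding any other point gives a base. -/
theorem SteinerSystem.isBase_insert (hr : 1 ≤ r) (hrk : r - 1 ≤ k) (hkn : k < n) {T H : Finset E}
    (hT : T.card = r - 1) (hH : H ∈ S.blocks) (hTH : T ⊆ H) {x : E} (hx : x ∉ H) :
    (S.matroid hr hrk hkn).IsBase (insert x (T : Set E)) := by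
  classical
  rw [S.matroid_isBase_iff]
  refine ⟨?_, fun H' hH' hsub => ?_⟩
  · rw [Set.ncard_insert_of_notMem (fun h => hx (hTH h)), Set.ncard_coe_finset, hT]
    omega
  · have : H' = H := (S.existsUnique_block T hT).unique
      ⟨hH', fun y hy => hsub (Set.mem_insert_of_mem _ hy)⟩ ⟨hH, hTH⟩
    exact hx (this ▸ hsub (Set.mem_insert x _))

/-- As `k < n`, some point lies off the block of `T`, and adding it to `T` gives a base. -/
theorem SteinerSystem.indep_of_card_eq (hr : 1 ≤ r) (hrk : r - 1 ≤ k) (hkn : k < n) {T : Finset E}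
    (hT : T.card = r - 1) : (S.matroid hr hrk hkn).Indep (T : Set E) := by
  obtain ⟨H, ⟨hH, hTH⟩, -⟩ := S.existsUnique_block T hT
  have hlt : H.card < (Finset.univ : Finset E).card := by
    rw [S.card_block H hH, Finset.card_univ, S.card_ground]; exact hkn
  obtain ⟨x, -, hx⟩ := Finset.exists_mem_notMem_of_card_lt_card hlt
  exact (S.isBase_insert hr hrk hkn hT hH hTH hx).indep.subset (Set.subset_insert _ _)

/-- A circuit with fewer than `r` elements would extend to an `(r - 1)`-set, which is independent.
-/
theorem SteinerSystem.matroid_isPaving (hr : 1 ≤ r) (hrk : r - 1 ≤ k) (hkn : k < n) :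
    (S.matroid hr hrk hkn).IsPaving := by
  intro X hX
  lift X to Finset E using Set.toFinite X
  rw [S.matroid_eRank, Set.encard_coe_eq_coe_finsetCard]
  by_contra hlt
  rw [Nat.cast_le, not_le] at hlt
  obtain ⟨T, hXT, hT⟩ := Finset.exists_superset_card_eq (s := X) (n := r - 1) (by omega)
    (by rw [S.card_ground]; omega)
  exact hX.not_indep ((S.indep_of_card_eq hr hrk hkn hT).subset (Finset.coe_subset.2 hXT))

/-- A point off `H` extends `T` to a base. A point of `H` outside `T` gives an `r`-set inside a
block; were it independent, its size would make it a base. -/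
theorem SteinerSystem.closure_eq_block (hr : 1 ≤ r) (hrk : r - 1 ≤ k) (hkn : k < n)
    {T H : Finset E} (hT : T.card = r - 1) (hH : H ∈ S.blocks) (hTH : T ⊆ H) :
    (S.matroid hr hrk hkn).closure (T : Set E) = H := by
  classical
  have hTi := S.indep_of_card_eq hr hrk hkn hT
  ext x
  rw [hTi.mem_closure_iff']
  constructor
  · rintro ⟨-, hx⟩
    by_contra hxH
    exact hxH (hTH (hx (S.isBase_insert hr hrk hkn hT hH hTH hxH).indep))
  · intro hx
    refine ⟨Set.mem_univ x, fun hi => ?_⟩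
    by_contra hxT
    have hsub : insert x (T : Set E) ⊆ H := Set.insert_subset hx (Finset.coe_subset.2 hTH)
    obtain ⟨B, hB, hiB⟩ := hi.exists_isBase_superset
    have hcard : (insert x (T : Set E)).ncard = r := by
      rw [Set.ncard_insert_of_notMem hxT, Set.ncard_coe_finset, hT]; omega
    have : insert x (T : Set E) = B :=
      Set.eq_of_subset_of_ncard_le hiB (by rw [hcard, hB.1]) (Set.toFinite B)
    exact hB.2 H hH (this ▸ hsub)

theorem SteinerSystem.isHyperplane_iff (hr : 1 ≤ r) (hrk : r - 1 ≤ k) (hkn : k < n) (H : Set E) :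
    (S.matroid hr hrk hkn).IsHyperplane H ↔ ∃ B ∈ S.blocks, (B : Set E) = H := by
  constructor
  · rintro ⟨hflat, hrank⟩
    obtain ⟨T, hT⟩ := (S.matroid hr hrk hkn).exists_isBasis H (Set.subset_univ H)
    have hcl := hT.closure_eq_closure
    have hTr := hT.encard_eq_eRk
    lift T to Finset E using Set.toFinite T
    have hTc : T.card = r - 1 := by
      rw [← hTr, S.matroid_eRank, Set.encard_coe_eq_coe_finsetCard] at hrank
      have : T.card + 1 = r := by exact_mod_cast hrank
      omega
    obtain ⟨B, ⟨hB, hTB⟩, -⟩ := S.existsUnique_block T hTc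
    refine ⟨B, hB, ?_⟩
    rw [← S.closure_eq_block hr hrk hkn hTc hB hTB, hcl, hflat.closure]
  · rintro ⟨B, hB, rfl⟩
    obtain ⟨T, hTB, hT⟩ := Finset.exists_subset_card_eq (s := B) (n := r - 1)
      (by rwa [S.card_block B hB])
    rw [← S.closure_eq_block hr hrk hkn hT hB hTB]
    refine ⟨Matroid.isFlat_closure _, ?_⟩
    rw [Matroid.eRk_closure_eq, (S.indep_of_card_eq hr hrk hkn hT).eRk_eq_encard,
      S.matroid_eRank, Set.encard_coe_eq_coe_finsetCard, hT]
    exact_mod_cast Nat.sub_add_cancel hr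

end

/-! ### The relative volume as the leading coefficient of the Ehrhart function -/

section

open Filter Topology MeasureTheory

variable {E : Type*} [Fintype E]

/-- The real coordinates, with respect to the chosen basis of the direction lattice. -/
def latticeMap (P : Set (E → ℝ)) :
    (Fin (Module.finrank ℤ (directionLattice P)) → ℝ) →ₗ[ℝ] (E → ℝ) where
  toFun c i := ∑ j, c j * (((Module.finBasis ℤ (directionLattice P) j : directionLattice P) : E → ℤ) i : ℝ)
  map_add' c c' := by
    funext i
    simp [add_mul, Finset.sum_add_distrib]
  map_smul' a c := by
    funext i
    simp [mul_assoc, Finset.mul_sum]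

/-- Integer vectors that are independent over `ℤ` stay independent over `ℝ`. -/
theorem latticeMap_injective (P : Set (E → ℝ)) : Function.Injective (latticeMap P) := by
  have h1 : LinearIndependent ℤ fun j =>
      ((Module.finBasis ℤ (directionLattice P) j : directionLattice P) : E → ℤ) :=
    (Module.finBasis ℤ (directionLattice P)).linearIndependent.map'
      (directionLattice P).subtype (Submodule.ker_subtype _)
  have h2 := (linearIndependent_algebraMap_comp_iff (S := ℝ)).2 h1
  rw [Fintype.linearIndependent_iff] at h2
  refine (injective_iff_map_eq_zero _).2 fun c hc => ?_
  funext j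
  refine h2 c ?_ j
  funext i
  have := congrFun hc i
  simpa [latticeMap] using this

/-- Integer coordinates of a vector of the direction lattice. -/
theorem exists_latticeMap_eq (P : Set (E → ℝ)) {v : E → ℤ} (hv : v ∈ directionLattice P) :
    ∃ c : Fin (Module.finrank ℤ (directionLattice P)) → ℤ,
      latticeMap P (fun j => (c j : ℝ)) = fun i => (v i : ℝ) := by
  refine ⟨(Module.finBasis ℤ (directionLattice P)).repr ⟨v, hv⟩, ?_⟩
  have h := congrArg (Subtype.val : directionLattice P → E → ℤ)
    ((Module.finBasis ℤ (directionLattice P)).sum_repr ⟨v, hv⟩)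
  funext i
  have hi := congrFun h i
  simp only [Submodule.coe_sum, Finset.sum_apply, Submodule.coe_smul, Pi.smul_apply,
    smul_eq_mul] at hi
  rw [← hi]
  simp [latticeMap]

theorem latticeMap_intCast_eq (P : Set (E → ℝ))
    (c : Fin (Module.finrank ℤ (directionLattice P)) → ℤ) :
    latticeMap P (fun j => (c j : ℝ)) = fun i =>
      ((∑ j, c j * ((Module.finBasis ℤ (directionLattice P) j : directionLattice P) : E → ℤ) i : ℤ)
        : ℝ) := by
  funext i
  simp [latticeMap]

/-- The body whose Lebesgue measure is the relative volume, with origin `x`. -/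
def latticeBody (P : Set (E → ℝ)) (x : E → ℝ) :
    Set (Fin (Module.finrank ℤ (directionLattice P)) → ℝ) :=
  {c | x + latticeMap P c ∈ P}

variable {V : Set (E → ℝ)} {z₀ : E → ℤ}

/-- The direction space is spanned by the differences `v - z₀` of points of `V`. These are integral,
so they have lattice coordinates, and those coordinates lie in the body. This yields both the change
of origin and the full dimension of the body. -/
theorem vectorSpan_convexHull_le_range (hV : ∀ v ∈ V, ∃ z : E → ℤ, (fun i => (z i : ℝ)) = v)
    (hz₀ : (fun i => (z₀ i : ℝ)) ∈ V) :
    vectorSpan ℝ (convexHull ℝ V) ≤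
      Submodule.span ℝ (latticeMap (convexHull ℝ V) ''
        latticeBody (convexHull ℝ V) (fun i => (z₀ i : ℝ))) := by
  have hsub := subset_convexHull ℝ V
  have h1 : vectorSpan ℝ (convexHull ℝ V) = vectorSpan ℝ V := by
    rw [← direction_affineSpan, affineSpan_convexHull, direction_affineSpan]
  rw [h1, vectorSpan_eq_span_vsub_set_right ℝ hz₀, Submodule.span_le]
  rintro _ ⟨v, hv, rfl⟩
  obtain ⟨z, rfl⟩ := hV v hv
  have hz : z - z₀ ∈ directionLattice (convexHull ℝ V) := by
    change (fun i => (((z - z₀) i : ℤ) : ℝ)) ∈ vectorSpan ℝ (convexHull ℝ V)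
    have := vsub_mem_vectorSpan ℝ (hsub hv) (hsub hz₀)
    convert this using 1
    funext i
    simp
  obtain ⟨c, hc⟩ := exists_latticeMap_eq _ hz
  refine Submodule.subset_span ⟨fun j => (c j : ℝ), ?_, ?_⟩
  · change (fun i => (z₀ i : ℝ)) + latticeMap (convexHull ℝ V) _ ∈ convexHull ℝ V
    rw [hc]
    convert hsub hv using 1
    funext i
    simp
  · rw [hc]
    funext i
    simp

/-- The chosen point of `P` need not be integral. Replacing it by `z₀` translates the body, which
preserves Lebesgue measure. -/
theorem relativeVolume_eq_volume_latticeBody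
    (hV : ∀ v ∈ V, ∃ z : E → ℤ, (fun i => (z i : ℝ)) = v) (hz₀ : (fun i => (z₀ i : ℝ)) ∈ V) :
    relativeVolume (convexHull ℝ V) =
      volume (latticeBody (convexHull ℝ V) (fun i => (z₀ i : ℝ))) := by
  have h0 := subset_convexHull ℝ V hz₀
  have hne : (convexHull ℝ V).Nonempty := ⟨_, h0⟩
  have h1 : relativeVolume (convexHull ℝ V) =
      volume (latticeBody (convexHull ℝ V) hne.some) := dif_pos hne
  have h2 : hne.some - (fun i => (z₀ i : ℝ)) ∈ LinearMap.range (latticeMap (convexHull ℝ V)) := by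
    have h3 := vectorSpan_convexHull_le_range hV hz₀
      (vsub_mem_vectorSpan ℝ hne.some_mem h0)
    refine Submodule.span_le.2 ?_ h3
    rintro _ ⟨c, -, rfl⟩
    exact ⟨c, rfl⟩
  obtain ⟨e, he⟩ := h2
  have h4 : latticeBody (convexHull ℝ V) hne.some =
      (fun c => e + c) ⁻¹' latticeBody (convexHull ℝ V) (fun i => (z₀ i : ℝ)) := by
    ext c
    change hne.some + latticeMap (convexHull ℝ V) c ∈ convexHull ℝ V ↔
      (fun i => (z₀ i : ℝ)) + latticeMap (convexHull ℝ V) (e + c) ∈ convexHull ℝ V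
    rw [map_add, he, ← add_assoc, add_sub_cancel]
  rw [h1, h4, measure_preimage_add]

theorem convex_latticeBody (P : Set (E → ℝ)) (hP : Convex ℝ P) (x : E → ℝ) :
    Convex ℝ (latticeBody P x) :=
  (hP.translate_preimage_right x).linear_preimage (latticeMap P)

theorem continuous_latticeMap (P : Set (E → ℝ)) : Continuous (latticeMap P) :=
  LinearMap.continuous_of_finiteDimensional _

theorem isClosed_latticeBody {P : Set (E → ℝ)} (hP : IsClosed P) (x : E → ℝ) :
    IsClosed (latticeBody P x) :=
  hP.preimage (continuous_const.add (continuous_latticeMap P))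

theorem isBounded_latticeBody {P : Set (E → ℝ)} (hP : Bornology.IsBounded P) (x : E → ℝ) :
    Bornology.IsBounded (latticeBody P x) := by
  obtain ⟨K, -, hK⟩ := (latticeMap P).exists_antilipschitzWith
    (LinearMap.ker_eq_bot.2 (latticeMap_injective P))
  have h1 : Bornology.IsBounded ((fun y => x + y) ⁻¹' P) :=
    (AntilipschitzWith.of_le_mul_dist (K := 1) fun a b => by simp).isBounded_preimage hP
  exact hK.isBounded_preimage h1

/-- The body is convex, contains 0 and spans the coordinate space, so it has nonempty interior. -/
theorem volume_latticeBody_pos (hV : ∀ v ∈ V, ∃ z : E → ℤ, (fun i => (z i : ℝ)) = v)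
    (hz₀ : (fun i => (z₀ i : ℝ)) ∈ V) :
    0 < volume (latticeBody (convexHull ℝ V) (fun i => (z₀ i : ℝ))) := by
  set S := latticeBody (convexHull ℝ V) (fun i => (z₀ i : ℝ)) with hS
  have h0 : (0 : Fin (Module.finrank ℤ (directionLattice (convexHull ℝ V))) → ℝ) ∈ S := by
    change (fun i => (z₀ i : ℝ)) + latticeMap (convexHull ℝ V) 0 ∈ convexHull ℝ V
    rw [map_zero, add_zero]
    exact subset_convexHull ℝ V hz₀
  have hspan : Submodule.span ℝ S = ⊤ := by
    rw [eq_top_iff]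
    intro c _
    have hmem : ∀ j, latticeMap (convexHull ℝ V) (Pi.single j 1) ∈
        (Submodule.span ℝ S).map (latticeMap (convexHull ℝ V)) := by
      intro j
      rw [Submodule.map_span]
      apply vectorSpan_convexHull_le_range hV hz₀
      have hj := (Module.finBasis ℤ (directionLattice (convexHull ℝ V)) j).2
      change (fun i => ((((Module.finBasis ℤ (directionLattice (convexHull ℝ V)) j :
        directionLattice (convexHull ℝ V)) : E → ℤ) i : ℤ) : ℝ)) ∈
        vectorSpan ℝ (convexHull ℝ V) at hj
      convert hj using 1
      funext i
      simp [latticeMap, Pi.single_apply]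
    have hj : ∀ j, (Pi.single j 1 : Fin _ → ℝ) ∈ Submodule.span ℝ S := by
      intro j
      obtain ⟨c, hc, hcj⟩ := hmem j
      rwa [← latticeMap_injective _ hcj]
    rw [← (Pi.basisFun ℝ _).sum_repr c]
    refine Submodule.sum_mem _ fun j _ => Submodule.smul_mem _ _ ?_
    simpa using hj j
  have haff : affineSpan ℝ S = ⊤ := by
    rw [AffineSubspace.affineSpan_eq_top_iff_vectorSpan_eq_top_of_nonempty ℝ _ _ ⟨0, h0⟩,
      vectorSpan_eq_span_vsub_set_right ℝ h0]
    simpa using hspan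
  have hint := ((convex_latticeBody _ (convex_convexHull ℝ V)
    (fun i => (z₀ i : ℝ))).interior_nonempty_iff_affineSpan_eq_top).2 haff
  exact Measure.measure_pos_of_nonempty_interior _ hint

/-- The point `c / t` of the body corresponds to the integer point `t z₀ + ∑ c_j b_j` of `t P`,
where `b` is the lattice basis; the integrality of `z₀` is essential here. -/
theorem card_latticeBody_inter (hz₀ : (fun i => (z₀ i : ℝ)) ∈ V) {t : ℕ} (ht : 0 < t) :
    Nat.card ↑(latticeBody (convexHull ℝ V) (fun i => (z₀ i : ℝ)) ∩
      (t : ℝ)⁻¹ •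
      (Submodule.span ℤ (Set.range (Pi.basisFun ℝ
        (Fin (Module.finrank ℤ (directionLattice (convexHull ℝ V)))))) : Set _)) =
      ehrhartFunction (convexHull ℝ V) t := by
  have : NeZero t := ⟨ht.ne'⟩
  have ht' : (t : ℝ) ≠ 0 := by positivity
  have h0 := subset_convexHull ℝ V hz₀
  set P := convexHull ℝ V with hP
  set C : Set (Fin (Module.finrank ℤ (directionLattice P)) → ℤ) :=
    {c | (t : ℝ)⁻¹ • (fun j => (c j : ℝ)) ∈ latticeBody P (fun i => (z₀ i : ℝ))} with hC
  set f : (Fin (Module.finrank ℤ (directionLattice P)) → ℤ) →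
    (Fin (Module.finrank ℤ (directionLattice P)) → ℝ) := fun c => (t : ℝ)⁻¹ • fun j => (c j : ℝ)
    with hf
  set g : (Fin (Module.finrank ℤ (directionLattice P)) → ℤ) → E → ℤ := fun c i =>
    t * z₀ i + ∑ j, c j * ((Module.finBasis ℤ (directionLattice P) j : directionLattice P) : E → ℤ) i
    with hg
  have hgc : ∀ c, (fun i => (g c i : ℝ)) =
      (t : ℝ) • ((fun i => (z₀ i : ℝ)) + latticeMap P (f c)) := by
    intro c
    rw [hf, map_smul, smul_add, smul_inv_smul₀ ht', latticeMap_intCast_eq]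
    funext i
    simp [hg]
  have hcast : Function.Injective fun (c : Fin (Module.finrank ℤ (directionLattice P)) → ℤ) j =>
      (c j : ℝ) := fun c c' h => funext fun j => Int.cast_injective (congrFun h j)
  have hfinj : Function.Injective f := fun c c' h =>
    hcast (smul_right_injective _ (inv_ne_zero ht') h)
  have hginj : Function.Injective g := by
    intro c c' h
    have := (hgc c).symm.trans ((congrArg (fun (z : E → ℤ) i => (z i : ℝ)) h).trans (hgc c'))
    exact hfinj (latticeMap_injective P (add_left_cancel (smul_right_injective _ ht' this)))
  have hgmem : ∀ c, c ∈ C ↔ (fun i => (g c i : ℝ)) ∈ (t : ℝ) • P := by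
    intro c
    rw [hgc, Set.smul_mem_smul_set_iff₀ ht']
    rfl
  have e1 : latticeBody P (fun i => (z₀ i : ℝ)) ∩
      (t : ℝ)⁻¹ •
      (Submodule.span ℤ (Set.range (Pi.basisFun ℝ
        (Fin (Module.finrank ℤ (directionLattice P))))) : Set _) = f '' C := by
    ext v
    rw [Set.mem_inter_iff, ← Submodule.coe_pointwise_smul, SetLike.mem_coe,
      BoxIntegral.unitPartition.mem_smul_span_iff]
    constructor
    · rintro ⟨hv, hint⟩
      choose c hc using hint
      have hcv : f c = v := by
        funext j
        have := hc j
        simp only [algebraMap_int_eq, eq_intCast] at this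
        simp [hf, this, ht']
      exact ⟨c, by change f c ∈ latticeBody P _; rwa [hcv], hcv⟩
    · rintro ⟨c, hc, rfl⟩
      refine ⟨hc, fun j => ⟨c j, ?_⟩⟩
      simp [hf, ht']
  have e2 : {z : E → ℤ | (fun i => (z i : ℝ)) ∈ (t : ℝ) • P} = g '' C := by
    ext z
    constructor
    · intro hz
      have hz' : (fun i => (z i : ℝ)) ∈ (t : ℝ) • P := hz
      obtain ⟨p, hp, hpz⟩ := hz'
      -- Write `z = t p` with `p ∈ P`; then `z - t z₀ = t (p - z₀)` is parallel to `P`.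
      have hdir : (fun i => z i - t * z₀ i) ∈ directionLattice P := by
        change (fun i => ((z i - t * z₀ i : ℤ) : ℝ)) ∈ vectorSpan ℝ P
        have := (vectorSpan ℝ P).smul_mem (t : ℝ) (vsub_mem_vectorSpan ℝ hp h0)
        convert this using 1
        funext i
        have := congrFun hpz i
        simp only [Pi.smul_apply, smul_eq_mul] at this
        simp [← this, mul_sub]
      obtain ⟨c, hc⟩ := exists_latticeMap_eq P hdir
      have hgz : g c = z := by
        have h3 := hgc c
        rw [hf, map_smul, smul_add, smul_inv_smul₀ ht', hc] at h3
        funext i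
        have := congrFun h3 i
        simp only [Pi.add_apply, Pi.smul_apply, smul_eq_mul] at this
        push_cast at this
        exact_mod_cast this.trans (by ring : (t : ℝ) * z₀ i + (z i - t * z₀ i) = z i)
      exact ⟨c, (hgmem c).2 (by rwa [hgz]), hgz⟩
    · rintro ⟨c, hc, rfl⟩
      exact (hgmem c).1 hc
  rw [ehrhartFunction, e1, e2, Nat.card_coe_set_eq, Set.ncard_image_of_injective _ hfinj,
    Set.ncard_image_of_injective _ hginj]

/-- The body is bounded with null frontier, by convexity, so counting points of a lattice refined by
`1 / t` computes its Lebesgue measure. -/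
theorem relativeVolume_spec (hfin : V.Finite)
    (hV : ∀ v ∈ V, ∃ z : E → ℤ, (fun i => (z i : ℝ)) = v) (hne : V.Nonempty) :
    relativeVolume (convexHull ℝ V) ≠ ⊤ ∧ 0 < (relativeVolume (convexHull ℝ V)).toReal ∧
    Tendsto (fun t : ℕ => (ehrhartFunction (convexHull ℝ V) t : ℝ) /
      (t : ℝ) ^ Module.finrank ℤ (directionLattice (convexHull ℝ V))) atTop
      (𝓝 (relativeVolume (convexHull ℝ V)).toReal) := by
  obtain ⟨v₀, hv₀⟩ := hne
  obtain ⟨z₀, rfl⟩ := hV v₀ hv₀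
  have hbdd : Bornology.IsBounded (convexHull ℝ V) := isBounded_convexHull.2 hfin.isBounded
  have hclosed : IsClosed (convexHull ℝ V) := hfin.isClosed_convexHull ℝ
  have hb := isBounded_latticeBody hbdd (fun i => (z₀ i : ℝ))
  have hc := isClosed_latticeBody hclosed (fun i => (z₀ i : ℝ))
  have hfr := (convex_latticeBody _ (convex_convexHull ℝ V)
    (fun i => (z₀ i : ℝ))).addHaar_frontier volume
  have hlim := tendsto_card_div_pow_atTop_volume _ hb hc.measurableSet hfr
  rw [Fintype.card_fin] at hlim
  rw [relativeVolume_eq_volume_latticeBody hV hv₀]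
  refine ⟨hb.measure_lt_top.ne, ENNReal.toReal_pos (volume_latticeBody_pos hV hv₀).ne'
    hb.measure_lt_top.ne, hlim.congr' ?_⟩
  filter_upwards [eventually_gt_atTop 0] with t ht
  rw [card_latticeBody_inter hv₀ ht]

/-- The growth of a function determines the exponent and the leading coefficient. -/
theorem eq_of_tendsto_div_pow {F : ℕ → ℝ} {d d' : ℕ} {v v' : ℝ} (hv : 0 < v) (hv' : 0 < v')
    (h : Tendsto (fun t : ℕ => F t / (t : ℝ) ^ d) atTop (𝓝 v))
    (h' : Tendsto (fun t : ℕ => F t / (t : ℝ) ^ d') atTop (𝓝 v')) : d = d' ∧ v = v' := by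
  have aux : ∀ {d d' : ℕ} {v v' : ℝ}, 0 < v' → d < d' →
      Tendsto (fun t : ℕ => F t / (t : ℝ) ^ d) atTop (𝓝 v) →
      Tendsto (fun t : ℕ => F t / (t : ℝ) ^ d') atTop (𝓝 v') → False := by
    intro d d' v v' hv' hlt h h'
    have h1 : Tendsto (fun t : ℕ => ((t : ℝ) ^ (d' - d))⁻¹) atTop (𝓝 0) :=
      tendsto_inv_atTop_zero.comp
        ((tendsto_pow_atTop (by omega)).comp tendsto_natCast_atTop_atTop)
    have h2 := h.mul h1
    rw [mul_zero] at h2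
    refine hv'.ne' (tendsto_nhds_unique h' (h2.congr fun t => ?_))
    rw [← div_eq_mul_inv, div_div, ← pow_add, Nat.add_sub_cancel' hlt.le]
  rcases lt_trichotomy d d' with hlt | rfl | hlt
  · exact (aux hv' hlt h h').elim
  · exact ⟨rfl, tendsto_nhds_unique h h'⟩
  · exact (aux hv hlt h' h).elim

/-- Positivity of both limits makes the growth exponents equal, hence also the factorials in
`normalizedVolume`. -/
theorem volumes_eq_of_ehrhartFunction_eq {E' : Type*} [Fintype E'] {V' : Set (E' → ℝ)}
    (hfin : V.Finite) (hV : ∀ v ∈ V, ∃ z : E → ℤ, (fun i => (z i : ℝ)) = v) (hne : V.Nonempty)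
    (hfin' : V'.Finite) (hV' : ∀ v ∈ V', ∃ z : E' → ℤ, (fun i => (z i : ℝ)) = v)
    (hne' : V'.Nonempty)
    (h : ∀ t, ehrhartFunction (convexHull ℝ V) t = ehrhartFunction (convexHull ℝ V') t) :
    relativeVolume (convexHull ℝ V) = relativeVolume (convexHull ℝ V') ∧
      normalizedVolume (convexHull ℝ V) = normalizedVolume (convexHull ℝ V') := by
  obtain ⟨ht, hpos, hlim⟩ := relativeVolume_spec hfin hV hne
  obtain ⟨ht', hpos', hlim'⟩ := relativeVolume_spec hfin' hV' hne'
  simp only [← h] at hlim'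
  obtain ⟨hd, hv⟩ := eq_of_tendsto_div_pow hpos hpos' hlim hlim'
  have hvol := (ENNReal.toReal_eq_toReal_iff' ht ht').1 hv
  exact ⟨hvol, by rw [normalizedVolume, normalizedVolume, hd, hvol]⟩

end

/-! ### Steiner systems with equal parameters -/

theorem SteinerSystem.ehrhartFunction_eq {E E' : Type*} [Fintype E] [Fintype E'] {r k n : ℕ}
    (hr : 1 ≤ r) (hrk : r - 1 ≤ k) (hkn : k < n) (S : SteinerSystem E (r - 1) k n)
    (S' : SteinerSystem E' (r - 1) k n) (t : ℕ) :
    ehrhartFunction (S.matroid hr hrk hkn).basePolytope t =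
      ehrhartFunction (S'.matroid hr hrk hkn).basePolytope t := by
  have h := S.isEhrhartPolynomial_matroid hr hrk hkn t
  rw [S'.isEhrhartPolynomial_matroid hr hrk hkn t] at h
  exact_mod_cast h.symm

theorem exists_intCast_eq_of_mem_image_indicator {E : Type*} (𝓑 : Set (Set E)) :
    ∀ v ∈ (fun B : Set E => B.indicator (fun _ => (1 : ℝ))) '' 𝓑,
      ∃ z : E → ℤ, (fun i => (z i : ℝ)) = v := by
  classical
  rintro _ ⟨B, -, rfl⟩
  refine ⟨B.indicator fun _ => 1, funext fun i => ?_⟩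
  by_cases hi : i ∈ B <;> simp [hi]

theorem SteinerSystem.volumes_eq {E E' : Type*} [Fintype E] [Fintype E'] {r k n : ℕ}
    (hr : 1 ≤ r) (hrk : r - 1 ≤ k) (hkn : k < n) (S : SteinerSystem E (r - 1) k n)
    (S' : SteinerSystem E' (r - 1) k n) :
    relativeVolume (S.matroid hr hrk hkn).basePolytope =
        relativeVolume (S'.matroid hr hrk hkn).basePolytope ∧
      normalizedVolume (S.matroid hr hrk hkn).basePolytope =
        normalizedVolume (S'.matroid hr hrk hkn).basePolytope :=
  volumes_eq_of_ehrhartFunction_eq (Set.toFinite _) (exists_intCast_eq_of_mem_image_indicator _)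
    (Set.Nonempty.image _ (S.matroid hr hrk hkn).exists_isBase) (Set.toFinite _)
    (exists_intCast_eq_of_mem_image_indicator _) (Set.Nonempty.image _ (S'.matroid hr hrk hkn).exists_isBase)
    (S.ehrhartFunction_eq hr hrk hkn S')

end

theorem mainTheorem8 :
    -- Steiner systems
    (∀ (E : Type*) [Fintype E] (r k n : ℕ) (hr : 1 ≤ r) (hrk : r - 1 ≤ k) (hkn : k < n)
        (S : SteinerSystem E (r - 1) k n),
      ((S.matroid hr hrk hkn).E = Set.univ ∧
        (S.matroid hr hrk hkn).eRank = (r : ℕ∞) ∧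
        (S.matroid hr hrk hkn).IsPaving ∧
        (∀ H : Set E, (S.matroid hr hrk hkn).IsHyperplane H ↔
          ∃ B ∈ S.blocks, (B : Set E) = H)) ∧
      ∃ u : ℚ[X],
        IsEhrhartPolynomial (uniformMatroid r n (by omega)).basePolytope u ∧
        IsEhrhartPolynomial (S.matroid hr hrk hkn).basePolytope
          (u - C ((n.choose (r - 1) : ℚ) / (k.choose (r - 1) : ℚ)) *
            C (((n : ℚ) - k) / ((n - 1).factorial : ℚ)) *
            binomPoly (X - 1 + C ((n : ℚ) - k)) (n - k) * phiTilde r k n)) ∧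
    -- projective planes of order `q`, where `n = q² + q + 1`
    (∀ (P L : Type*) [Membership P L] [Configuration.ProjectivePlane P L] [Fintype P] [Finite L]
        (q : ℕ) (hq : Configuration.ProjectivePlane.order P L = q) (hq2 : 2 ≤ q),
      ∃ u : ℚ[X],
        IsEhrhartPolynomial (uniformMatroid 3 (q ^ 2 + q + 1) (by nlinarith)).basePolytope u ∧
        IsEhrhartPolynomial (planeMatroid P L q hq hq2).basePolytope
          (u - C (((q ^ 2 + q + 1).choose 2 : ℚ) / ((q + 1).choose 2 : ℚ)) *
            C ((q : ℚ) ^ 2 / ((q ^ 2 + q).factorial : ℚ)) *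
            binomPoly (X + C ((q : ℚ) ^ 2 - 1)) (q ^ 2 + q + 1 - q - 1) *
            phiTilde 3 (q + 1) (q ^ 2 + q + 1))) ∧
    -- Ehrhart polynomials and volumes depend only on the parameters
    (∀ (E E' : Type*) [Fintype E] [Fintype E'] (r k n : ℕ)
        (hr : 1 ≤ r) (hrk : r - 1 ≤ k) (hkn : k < n)
        (S : SteinerSystem E (r - 1) k n) (S' : SteinerSystem E' (r - 1) k n),
      (∀ f : ℚ[X], IsEhrhartPolynomial (S.matroid hr hrk hkn).basePolytope f ↔
        IsEhrhartPolynomial (S'.matroid hr hrk hkn).basePolytope f) ∧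
      relativeVolume (S.matroid hr hrk hkn).basePolytope =
        relativeVolume (S'.matroid hr hrk hkn).basePolytope ∧
      normalizedVolume (S.matroid hr hrk hkn).basePolytope =
        normalizedVolume (S'.matroid hr hrk hkn).basePolytope) := by
  refine ⟨?_, ?_, ?_⟩
  · intro E _ r k n hr hrk hkn S
    exact ⟨⟨S.matroid_E hr hrk hkn, S.matroid_eRank hr hrk hkn, S.matroid_isPaving hr hrk hkn,
      S.isHyperplane_iff hr hrk hkn⟩, uniformEhrhart r n,
      isEhrhartPolynomial_uniformMatroid r n _ hr, S.isEhrhartPolynomial_matroid hr hrk hkn⟩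
  · intro P L _ _ _ _ q hq hq2
    refine ⟨uniformEhrhart 3 (q ^ 2 + q + 1),
      isEhrhartPolynomial_uniformMatroid 3 _ _ (by norm_num), ?_⟩
    have h := SteinerSystem.isEhrhartPolynomial_matroid (r := 3) (planeSteinerSystem P L q hq)
      (by omega) (by omega) (by nlinarith)
    have e1 : ((q ^ 2 + q + 1 : ℕ) : ℚ) - ((q + 1 : ℕ) : ℚ) = (q : ℚ) ^ 2 := by push_cast; ring
    have e2 : (X - 1 + C ((q : ℚ) ^ 2) : ℚ[X]) = X + C ((q : ℚ) ^ 2 - 1) := by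
      rw [C_sub, C_1]; ring
    rw [e1, e2, Nat.add_sub_cancel, show q ^ 2 + q + 1 - (q + 1) = q ^ 2 + q + 1 - q - 1 by omega]
      at h
    exact h
  · intro E E' _ _ r k n hr hrk hkn S S'
    refine ⟨fun f => ?_, S.volumes_eq hr hrk hkn S'⟩
    simp only [IsEhrhartPolynomial, S.ehrhartFunction_eq hr hrk hkn S']
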